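/- Let $d\in[0,1)$ and $\alpha>-d$. Let $\pi=(\pi_i)_{i\ge 1}$ be a random sequence with $\pi\sim\mathrm{PY}(d,\alpha)$, that is, up to a (possibly random) reordering, $\pi$ is distributed as the stick-breaking sequence $\tilde\pi_i=\beta_i\prod_{j=1}^{i-1}(1-\beta_j)$, $i\ge 1$, where $\beta_1,\beta_2,\dots$ are independent and $\beta_i\sim\mathrm{Beta}(1-d,\alpha+id)$. (Precisely: $\pi$ can be coupled with such a sequence $(\beta_i)$ so that almost surely $(\tilde\pi_i)$ is a permutation of $(\pi_i)$. This includes both the stick-breaking order, the GEM distribution, and the decreasing order, the two-parameter Poisson--Dirichlet distribution.) Let $H=H(\pi)=-\sum_{i=1}^\infty \pi_i\log\pi_i$ be the entropy of $\pi$ (natural logarithm, $0\log 0=0$), and let $\psi_0=\Gamma'/\Gamma$ and $\psi_1=\psi_0'$ be the digamma and trigamma functions. Then the series defining $H$ converges absolutely almost surely, $H$ is square-integrable, and $$\mathbb{E}[H]=\psi_0(\alpha+1)-\psi_0(1-d),$$ $$\mathrm{Var}[H]=\frac{\alpha+d}{(\alpha+1)^2(1-d)}+\frac{1-d}{\alpha+1}\,\psi_1(2-d)-\psi_1(2+\alpha).$$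 -/

import Mathlib

open MeasureTheory ProbabilityTheory

namespace PitmanYor

/-- The polygamma function `ψ_n` on the real line: the `n`-th derivative of the digamma function
`ψ₀ = Γ' / Γ`. -/
noncomputable def polygamma (n : ℕ) : ℝ → ℝ :=
  iteratedDeriv n (logDeriv Real.Gamma)

/-- On the positive half-line `ψ₀` is the restriction of Mathlib's complex digamma function. -/
theorem polygamma_zero_eq_digamma {x : ℝ} (hx : 0 < x) :
    ((polygamma 0 x : ℝ) : ℂ) = Complex.digamma (x : ℂ) := by
  have hne : ∀ m : ℕ, (x : ℂ) ≠ -(m : ℂ) := by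
    intro m h
    have h2 : x = -(m : ℝ) := by exact_mod_cast h
    have h3 : (0 : ℝ) ≤ m := Nat.cast_nonneg m
    linarith
  have h1 := (Complex.differentiableAt_Gamma (x : ℂ) hne).hasDerivAt.comp_ofReal
  have h4 : (fun y : ℝ => Complex.Gamma (y : ℂ)) = fun y : ℝ => ((Real.Gamma y : ℝ) : ℂ) := by
    funext y
    exact Complex.Gamma_ofReal y
  have h5 : DifferentiableAt ℝ Real.Gamma x := by
    apply Real.differentiableAt_Gamma
    intro m h
    exact hne m (by exact_mod_cast h)
  rw [h4] at h1
  have h6 := h1.unique h5.hasDerivAt.ofReal_comp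
  simp only [polygamma, iteratedDeriv_zero, Complex.digamma_def, logDeriv_apply, h6,
    Complex.Gamma_ofReal, Complex.ofReal_div]

/-- The stick-breaking map: from the break fractions `b 0, b 1, …` it forms the weights
`(1 - b 0) ⋯ (1 - b (i - 1)) * b i`. -/
noncomputable def stickBreaking (b : ℕ → ℝ) (i : ℕ) : ℝ :=
  (∏ j ∈ Finset.range i, (1 - b j)) * b i

/-- The break fractions `b 0, b 1, …` are independent, and (counting from `0`) the `i`-th one has
law `Beta(1 - d, α + (i + 1) d)`. -/
structure IsStickFractions {Ω : Type*} [MeasurableSpace Ω] (d α : ℝ) (b : ℕ → Ω → ℝ)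
    (P : Measure Ω) : Prop where
  hasLaw : ∀ i : ℕ, HasLaw (b i) (betaMeasure (1 - d) (α + ((i : ℝ) + 1) * d)) P
  indep : iIndepFun b P

/-- `π ∼ PY(d, α)`, as a statement about the law of the random weight sequence `π`: up to
relabelling of the (unordered) atoms, `π` is distributed as the stick-breaking sequence. That is,
there is a coupling `ν` of `π` (first component) with a sequence of break fractions (second
component) under which the stick-breaking weights are almost surely a permutation of `π`. This
covers the weights in their size-biased order (the GEM law), in decreasing order (the
two-parameter Poisson-Dirichlet law), and in any other order, possibly random. -/
def IsPitmanYor {Ω : Type*} [MeasurableSpace Ω] (d α : ℝ) (π : Ω → ℕ → ℝ)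
    (P : Measure Ω) : Prop :=
  AEMeasurable π P ∧
    ∃ ν : Measure ((ℕ → ℝ) × (ℕ → ℝ)),
      ν.map Prod.fst = P.map π ∧
      IsStickFractions d α (fun i x => x.2 i) ν ∧
      ∀ᵐ x ∂ν, ∃ σ : Equiv.Perm ℕ, ∀ i, stickBreaking x.2 i = x.1 (σ i)

theorem measurable_stickBreaking : Measurable stickBreaking := by
  refine measurable_pi_lambda _ fun i => ?_
  unfold stickBreaking
  fun_prop

/-- The stick-breaking weights themselves are `PY(d, α)`. -/
theorem IsStickFractions.isPitmanYor {Ω : Type*} [MeasurableSpace Ω] {d α : ℝ} {b : ℕ → Ω → ℝ}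
    {P : Measure Ω} (h : IsStickFractions d α b P) :
    IsPitmanYor d α (fun ω => stickBreaking fun i => b i ω) P := by
  have hb : AEMeasurable (fun ω i => b i ω) P := aemeasurable_pi_lambda _ fun i =>
    (h.hasLaw i).aemeasurable
  have hs : Measurable fun q : ℕ → ℝ => (stickBreaking q, q) :=
    measurable_stickBreaking.prodMk measurable_id
  have hS := measurable_stickBreaking.comp_aemeasurable hb
  have hF : AEMeasurable (fun ω => (stickBreaking (fun i => b i ω), fun i => b i ω)) P :=
    hs.comp_aemeasurable hb
  refine ⟨hS, P.map (fun ω => (stickBreaking (fun i => b i ω), fun i => b i ω)), ?_, ⟨?_, ?_⟩, ?_⟩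
  · rw [AEMeasurable.map_map_of_aemeasurable measurable_fst.aemeasurable hF]
    rfl
  · intro i
    have hm : Measurable fun x : (ℕ → ℝ) × (ℕ → ℝ) => x.2 i := by fun_prop
    refine ⟨hm.aemeasurable, ?_⟩
    rw [AEMeasurable.map_map_of_aemeasurable hm.aemeasurable hF]
    exact (h.hasLaw i).map_eq
  · have := h.indep.isProbabilityMeasure
    have hm : ∀ i, Measurable fun x : (ℕ → ℝ) × (ℕ → ℝ) => x.2 i := fun i => by fun_prop
    have := Measure.isProbabilityMeasure_map (μ := P) hF
    rw [iIndepFun_iff_map_fun_eq_infinitePi_map hm]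
    have h2 := (iIndepFun_iff_map_fun_eq_infinitePi_map₀ hb).1 h.indep
    rw [AEMeasurable.map_map_of_aemeasurable (by fun_prop) hF]
    have h3 : (P.map fun ω i => b i ω) = _ := h2
    refine h3.trans ?_
    congr 1
    funext i
    rw [AEMeasurable.map_map_of_aemeasurable (hm i).aemeasurable hF]
    rfl
  · have hm : ∀ᵐ x ∂(P.map (fun ω => (stickBreaking (fun i => b i ω), fun i => b i ω))),
        x.1 = stickBreaking x.2 := by
      refine (ae_map_iff hF (measurableSet_eq_fun measurable_fst
        (measurable_stickBreaking.comp measurable_snd))).2 ?_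
      exact Filter.Eventually.of_forall fun ω => rfl
    filter_upwards [hm] with x hx
    exact ⟨1, fun i => by rw [hx]; rfl⟩

/-- The entropy `H(p) = -∑ p_i log p_i` (natural logarithm, `0 log 0 = 0`). -/
noncomputable def entropy (p : ℕ → ℝ) : ℝ :=
  -∑' i, p i * Real.log (p i)

end PitmanYor

/-! Breaking `PY(d, α)` once leaves a fraction `β ∼ Beta(1 - d, α + d)` and an independent copy of
`PY(d, α + d)` scaled by `1 - β`. By the chain rule for entropy, `H = h(β) + (1 - β) H'`, where `h`
is binary entropy. Hence the claimed mean `F` and variance `V` must satisfy `F(α) = E[h(β) + (1 - β)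
F(α + d)]` and `V(α) = E[(h(β) + (1 - β) F(α + d) - F(α))²] + E[(1 - β)²] V(α + d)`. These are
`integral_step` and `integral_step_sq`; both reduce to logarithmic Beta moments and the recurrences
of the polygamma functions.

The recursions alone do not determine the moments of `H`, so they are iterated. Let `R_n` be the
stick left after `n` breaks and `G_n = ∑_{i<n} R_i h(β_i)`. The compensated process `M_n = G_n + R_n
F(α + n d)` is a martingale: `E M_n = F(α)`, and its orthogonal increments telescope to `E M_n² =
F(α)² + V(α) - E[R_n²] V(α + n d)`.

With `S_n = ∑_{j<n} 1 / (α + 1 + j d) → ∞`, one has `E R_n ≤ exp(-(1 - d) S_n)` and `F(α + n d) ≤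
F(α) + S_n`, while `V(α + n d)` stays bounded. The correction terms therefore vanish, and `G_n`,
which increases to `H`, has the same limiting first and second moments. Monotone convergence gives
the result for the stick-breaking order; permutation invariance of entropy carries it through the
coupling. -/

namespace PitmanYor

open Filter Topology

/-! ### Digamma and trigamma on the positive half-line -/

theorem analyticAt_Gamma {x : ℝ} (hx : 0 < x) : AnalyticAt ℝ Real.Gamma x := by
  have h : AnalyticAt ℂ Complex.Gamma (x : ℂ) := by
    have hd : DifferentiableOn ℂ Complex.Gamma {z | 0 < z.re} := fun z hz =>
      (Complex.differentiableAt_Gamma z fun m hm => by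
        have h0 : 0 < z.re := hz
        have h1 : (0 : ℝ) ≤ m := m.cast_nonneg
        simp [hm] at h0
        linarith).differentiableWithinAt
    exact hd.analyticAt ((isOpen_lt continuous_const Complex.continuous_re).mem_nhds (by simpa))
  exact h.re_ofReal

theorem hasDerivAt_log_Gamma {x : ℝ} (hx : 0 < x) :
    HasDerivAt (fun y => Real.log (Real.Gamma y)) (polygamma 0 x) x := by
  have h := (analyticAt_Gamma hx).differentiableAt.hasDerivAt.log (Real.Gamma_pos_of_pos hx).ne'
  simpa [polygamma, logDeriv_apply] using h

theorem hasDerivAt_polygamma_zero {x : ℝ} (hx : 0 < x) :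
    HasDerivAt (polygamma 0) (polygamma 1 x) x := by
  have h : AnalyticAt ℝ (logDeriv Real.Gamma) x :=
    (analyticAt_Gamma hx).deriv.div (analyticAt_Gamma hx) (Real.Gamma_pos_of_pos hx).ne'
  simpa [polygamma, iteratedDeriv_one] using h.differentiableAt.hasDerivAt

theorem polygamma_zero_add_one {x : ℝ} (hx : 0 < x) :
    polygamma 0 (x + 1) = polygamma 0 x + x⁻¹ := by
  have h1 := (hasDerivAt_log_Gamma (by linarith : 0 < x + 1)).comp_add_const x 1
  have h2 := (hasDerivAt_log_Gamma hx).add (Real.hasDerivAt_log hx.ne')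
  refine h1.unique (h2.congr_of_eventuallyEq ?_)
  filter_upwards [lt_mem_nhds hx] with y hy
  simp only [Pi.add_apply]
  rw [Real.Gamma_add_one hy.ne', Real.log_mul hy.ne' (Real.Gamma_pos_of_pos hy).ne', add_comm]

theorem polygamma_one_add_one {x : ℝ} (hx : 0 < x) :
    polygamma 1 (x + 1) = polygamma 1 x - (x ^ 2)⁻¹ := by
  have h1 := (hasDerivAt_polygamma_zero (by linarith : 0 < x + 1)).comp_add_const x 1
  have h2 := (hasDerivAt_polygamma_zero hx).add (hasDerivAt_inv hx.ne')
  rw [sub_eq_add_neg]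
  refine h1.unique (h2.congr_of_eventuallyEq ?_)
  filter_upwards [lt_mem_nhds hx] with y hy using polygamma_zero_add_one hy

/-- Log-convexity of `Γ`: its logarithm has a monotone derivative. -/
theorem polygamma_zero_mono {x y : ℝ} (hx : 0 < x) (hxy : x ≤ y) :
    polygamma 0 x ≤ polygamma 0 y := by
  have h := Real.convexOn_log_Gamma.monotoneOn_deriv (fun z hz =>
    (hasDerivAt_log_Gamma hz).differentiableAt)
  have := h (Set.mem_Ioi.2 hx) (Set.mem_Ioi.2 (hx.trans_le hxy)) hxy
  rwa [show Real.log ∘ Real.Gamma = fun y => Real.log (Real.Gamma y) from rfl,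
    (hasDerivAt_log_Gamma hx).deriv, (hasDerivAt_log_Gamma (hx.trans_le hxy)).deriv] at this

theorem polygamma_one_nonneg {x : ℝ} (hx : 0 < x) : 0 ≤ polygamma 1 x := by
  have hm : MonotoneOn (polygamma 0) (Set.Ioi 0) := fun y hy z _ hyz => polygamma_zero_mono hy hyz
  rw [← (hasDerivAt_polygamma_zero hx).deriv,
    ← derivWithin_of_isOpen isOpen_Ioi (Set.mem_Ioi.2 hx)]
  exact hm.derivWithin_nonneg

/-! ### Beta laws and their tilts by powers -/

theorem beta_add_one_left {a b : ℝ} (ha : 0 < a) (hb : 0 < b) :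
    beta (a + 1) b = a / (a + b) * beta a b := by
  have hab : 0 < a + b := add_pos ha hb
  have := (Real.Gamma_pos_of_pos hab).ne'
  rw [beta, beta, Real.Gamma_add_one ha.ne', add_right_comm, Real.Gamma_add_one hab.ne']
  field_simp

theorem beta_add_one_right {a b : ℝ} (ha : 0 < a) (hb : 0 < b) :
    beta a (b + 1) = b / (a + b) * beta a b := by
  have hab : 0 < a + b := add_pos ha hb
  have := (Real.Gamma_pos_of_pos hab).ne'
  rw [beta, beta, Real.Gamma_add_one hb.ne', ← add_assoc, Real.Gamma_add_one hab.ne']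
  field_simp

theorem ae_betaMeasure_mem_Ioo (a b : ℝ) : ∀ᵐ x ∂betaMeasure a b, x ∈ Set.Ioo (0 : ℝ) 1 := by
  rw [betaMeasure, ae_withDensity_iff (by unfold betaPDF; fun_prop)]
  refine ae_of_all _ fun x hx => ?_
  by_contra h
  exact hx (by rw [betaPDF_eq, if_neg (by exact h), ENNReal.ofReal_zero])

/-- The tilt adds `s` and `t` to the exponents of the Beta density, so only the normalising constant
changes. Every Beta moment below comes from this. -/
theorem betaMeasure_withDensity {a b s t : ℝ} (ha : 0 < a) (hb : 0 < b) (hs : 0 < a + s)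
    (ht : 0 < b + t) :
    (betaMeasure a b).withDensity (fun x => ENNReal.ofReal (x ^ s * (1 - x) ^ t))
      = ENNReal.ofReal (beta (a + s) (b + t) / beta a b) • betaMeasure (a + s) (b + t) := by
  have hm : ∀ a b, Measurable (betaPDF a b) := fun a b => by unfold betaPDF; fun_prop
  rw [betaMeasure, betaMeasure, ← withDensity_mul _ (hm _ _) (by fun_prop),
    ← withDensity_smul _ (hm _ _)]
  congr 1
  funext x
  have h1 := beta_pos ha hb
  have h2 := beta_pos hs ht
  simp only [Pi.mul_apply, Pi.smul_apply, smul_eq_mul]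
  by_cases hx : 0 < x ∧ x < 1
  · have hx' : 0 < 1 - x := by linarith [hx.2]
    rw [betaPDF_of_pos_lt_one hx.1 hx.2, betaPDF_of_pos_lt_one hx.1 hx.2,
      ← ENNReal.ofReal_mul (by have := hx.1; positivity), ← ENNReal.ofReal_mul (by positivity)]
    congr 1
    rw [show a + s - 1 = (a - 1) + s by ring, show b + t - 1 = (b - 1) + t by ring,
      Real.rpow_add hx.1, Real.rpow_add hx']
    field_simp
  · simp [betaPDF_eq, if_neg hx]

theorem integral_betaMeasure_rpow_mul {a b s t : ℝ} (ha : 0 < a) (hb : 0 < b) (hs : 0 < a + s)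
    (ht : 0 < b + t) (f : ℝ → ℝ) :
    ∫ x, x ^ s * (1 - x) ^ t * f x ∂betaMeasure a b
      = beta (a + s) (b + t) / beta a b * ∫ x, f x ∂betaMeasure (a + s) (b + t) := by
  have h := congrArg (fun μ => ∫ x, f x ∂μ) (betaMeasure_withDensity ha hb hs ht)
  have h1 := beta_pos ha hb
  have h2 := beta_pos hs ht
  simp only [integral_smul_measure] at h
  rw [integral_withDensity_eq_integral_toReal_smul (by fun_prop) (by simp),
    ENNReal.toReal_ofReal (by positivity), smul_eq_mul] at h
  rw [← h]
  refine integral_congr_ae ?_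
  filter_upwards [ae_betaMeasure_mem_Ioo a b] with x hx
  have hx0 := hx.1
  have hx' : 0 < 1 - x := by linarith [hx.2]
  rw [ENNReal.toReal_ofReal (by positivity), smul_eq_mul]

theorem integrable_betaMeasure_rpow_mul {a b s t : ℝ} (ha : 0 < a) (hb : 0 < b) (hs : 0 < a + s)
    (ht : 0 < b + t) {f : ℝ → ℝ} (hf : Integrable f (betaMeasure (a + s) (b + t))) :
    Integrable (fun x => x ^ s * (1 - x) ^ t * f x) (betaMeasure a b) := by
  have h := hf.smul_measure
    (ENNReal.ofReal_ne_top (r := beta (a + s) (b + t) / beta a b))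
  rw [← betaMeasure_withDensity ha hb hs ht,
    integrable_withDensity_iff_integrable_smul' (by fun_prop) (by simp)] at h
  refine h.congr ?_
  filter_upwards [ae_betaMeasure_mem_Ioo a b] with x hx
  have hx0 := hx.1
  have hx' : 0 < 1 - x := by linarith [hx.2]
  rw [ENNReal.toReal_ofReal (by positivity), smul_eq_mul]

/-! ### Logarithmic moments of Beta laws through the cumulant generating function -/

theorem exp_mul_add_mul_log_eq {x : ℝ} (hx : x ∈ Set.Ioo (0 : ℝ) 1) (s t u : ℝ) :
    Real.exp (u * (s * Real.log x + t * Real.log (1 - x)))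
      = x ^ (u * s) * (1 - x) ^ (u * t) * 1 := by
  rw [Real.rpow_def_of_pos hx.1, Real.rpow_def_of_pos (by linarith [hx.2]), ← Real.exp_add]
  ring_nf

theorem eventually_shape_pos {a : ℝ} (ha : 0 < a) (s : ℝ) : ∀ᶠ u in 𝓝 (0 : ℝ), 0 < a + u * s :=
  (show ContinuousAt (fun u : ℝ => a + u * s) 0 by fun_prop).eventually
    (lt_mem_nhds (by simpa using ha))

theorem integrable_exp_logs {a b : ℝ} (ha : 0 < a) (hb : 0 < b) {s t u : ℝ}
    (hs : 0 < a + u * s) (ht : 0 < b + u * t) :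
    Integrable (fun x => Real.exp (u * (s * Real.log x + t * Real.log (1 - x))))
      (betaMeasure a b) := by
  have := isProbabilityMeasureBeta hs ht
  refine (integrable_betaMeasure_rpow_mul ha hb hs ht (integrable_const (1 : ℝ))).congr ?_
  filter_upwards [ae_betaMeasure_mem_Ioo a b] with x hx
  rw [exp_mul_add_mul_log_eq hx]

theorem mgf_logs {a b : ℝ} (ha : 0 < a) (hb : 0 < b) {s t u : ℝ}
    (hs : 0 < a + u * s) (ht : 0 < b + u * t) :
    mgf (fun x => s * Real.log x + t * Real.log (1 - x)) (betaMeasure a b) u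
      = beta (a + u * s) (b + u * t) / beta a b := by
  have := isProbabilityMeasureBeta hs ht
  have h := integral_betaMeasure_rpow_mul ha hb hs ht fun _ => (1 : ℝ)
  simp only [integral_const, probReal_univ, smul_eq_mul, mul_one] at h
  rw [← h, mgf]
  refine integral_congr_ae ?_
  filter_upwards [ae_betaMeasure_mem_Ioo a b] with x hx
  simp only [exp_mul_add_mul_log_eq hx, mul_one]

theorem zero_mem_interior_integrableExpSet_logs {a b : ℝ} (ha : 0 < a) (hb : 0 < b) (s t : ℝ) :
    0 ∈ interior (integrableExpSet (fun x => s * Real.log x + t * Real.log (1 - x))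
      (betaMeasure a b)) := by
  rw [mem_interior_iff_mem_nhds]
  filter_upwards [eventually_shape_pos ha s, eventually_shape_pos hb t] with u hu hv
  exact integrable_exp_logs ha hb hu hv

theorem log_beta {a b : ℝ} (ha : 0 < a) (hb : 0 < b) :
    Real.log (beta a b) = Real.log (Real.Gamma a) + Real.log (Real.Gamma b)
      - Real.log (Real.Gamma (a + b)) := by
  have h1 := (Real.Gamma_pos_of_pos ha).ne'
  have h2 := (Real.Gamma_pos_of_pos hb).ne'
  rw [beta, Real.log_div (mul_ne_zero h1 h2) (Real.Gamma_pos_of_pos (add_pos ha hb)).ne',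
    Real.log_mul h1 h2]

/-- Up to a constant the cumulant generating function is `log Γ(a + us) + log Γ(b + ut) - log Γ(a +
b + u(s + t))`. Keeping `s` and `t` general covers both logarithms, and their product by
polarisation. -/
theorem hasDerivAt_cgf_logs {a b : ℝ} (ha : 0 < a) (hb : 0 < b) {s t u : ℝ}
    (hs : 0 < a + u * s) (ht : 0 < b + u * t) :
    HasDerivAt (cgf (fun x => s * Real.log x + t * Real.log (1 - x)) (betaMeasure a b))
      (polygamma 0 (a + u * s) * s + polygamma 0 (b + u * t) * t
        - polygamma 0 (a + b + u * (s + t)) * (s + t)) u := by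
  have hl : ∀ c r : ℝ, HasDerivAt (fun v : ℝ => c + v * r) r u := fun c r => by
    simpa using ((hasDerivAt_id u).mul_const r).const_add c
  have hst : 0 < a + b + u * (s + t) := by nlinarith
  have h1 := (hasDerivAt_log_Gamma hs).comp u (hl a s)
  have h2 := (hasDerivAt_log_Gamma ht).comp u (hl b t)
  have h3 := (hasDerivAt_log_Gamma hst).comp u (hl (a + b) (s + t))
  refine (((h1.add h2).sub h3).sub_const (Real.log (beta a b))).congr_of_eventuallyEq ?_
  filter_upwards [(hl a s).continuousAt.eventually (lt_mem_nhds hs),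
    (hl b t).continuousAt.eventually (lt_mem_nhds ht)] with v hv hw
  rw [cgf, mgf_logs ha hb hv hw, Real.log_div (beta_pos hv hw).ne' (beta_pos ha hb).ne',
    log_beta hv hw, show a + v * s + (b + v * t) = a + b + v * (s + t) by ring]
  rfl

theorem memLp_logs {a b : ℝ} (ha : 0 < a) (hb : 0 < b) (s t : ℝ) (p : NNReal) :
    MemLp (fun x => s * Real.log x + t * Real.log (1 - x)) p (betaMeasure a b) :=
  memLp_of_mem_interior_integrableExpSet (zero_mem_interior_integrableExpSet_logs ha hb s t) p

theorem integral_logs {a b : ℝ} (ha : 0 < a) (hb : 0 < b) (s t : ℝ) :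
    ∫ x, (s * Real.log x + t * Real.log (1 - x)) ∂betaMeasure a b
      = polygamma 0 a * s + polygamma 0 b * t - polygamma 0 (a + b) * (s + t) := by
  have := isProbabilityMeasureBeta ha hb
  have h := deriv_cgf_zero (zero_mem_interior_integrableExpSet_logs ha hb s t)
  rw [(hasDerivAt_cgf_logs ha hb (u := 0) (by simpa) (by simpa)).deriv] at h
  simpa using h.symm

theorem integral_logs_sq {a b : ℝ} (ha : 0 < a) (hb : 0 < b) (s t : ℝ) :
    ∫ x, (s * Real.log x + t * Real.log (1 - x)) ^ 2 ∂betaMeasure a b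
      = polygamma 1 a * s ^ 2 + polygamma 1 b * t ^ 2 - polygamma 1 (a + b) * (s + t) ^ 2
        + (polygamma 0 a * s + polygamma 0 b * t - polygamma 0 (a + b) * (s + t)) ^ 2 := by
  have := isProbabilityMeasureBeta ha hb
  have h := iteratedDeriv_two_cgf (zero_mem_interior_integrableExpSet_logs ha hb s t)
  rw [(hasDerivAt_cgf_logs ha hb (u := 0) (by simpa) (by simpa)).deriv] at h
  have hl : ∀ c r : ℝ, HasDerivAt (fun v : ℝ => c + v * r) r 0 := fun c r => by
    simpa using ((hasDerivAt_id (0 : ℝ)).mul_const r).const_add c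
  have hp : ∀ c r : ℝ, 0 < c →
      HasDerivAt (fun v : ℝ => polygamma 0 (c + v * r) * r) (polygamma 1 c * r * r) 0 := by
    intro c r hc
    have h1 := (hasDerivAt_polygamma_zero (x := c + 0 * r) (by simpa)).comp (0 : ℝ) (hl c r)
    simpa using h1.mul_const r
  have h2 := (((hp a s ha).add (hp b t hb)).sub (hp (a + b) (s + t) (add_pos ha hb)))
  -- The formula is needed on a neighbourhood of `0`, since it is differentiated once more there.
  have h3 : deriv (cgf (fun x => s * Real.log x + t * Real.log (1 - x)) (betaMeasure a b))
      =ᶠ[𝓝 0] fun u => polygamma 0 (a + u * s) * s + polygamma 0 (b + u * t) * t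
        - polygamma 0 (a + b + u * (s + t)) * (s + t) := by
    filter_upwards [eventually_shape_pos ha s, eventually_shape_pos hb t] with u hu hv
    exact (hasDerivAt_cgf_logs ha hb hu hv).deriv
  rw [iteratedDeriv_succ, iteratedDeriv_one, h3.deriv_eq] at h
  have h4 := h2.deriv
  simp only [Pi.add_def, Pi.sub_def] at h4
  rw [h4] at h
  simp at h
  linarith

theorem integrable_log {a b : ℝ} (ha : 0 < a) (hb : 0 < b) :
    Integrable Real.log (betaMeasure a b) := by
  have h := memLp_logs ha hb 1 0 1
  simp only [one_mul, zero_mul, add_zero] at h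
  exact memLp_one_iff_integrable.1 h

theorem integrable_log_one_sub {a b : ℝ} (ha : 0 < a) (hb : 0 < b) :
    Integrable (fun x => Real.log (1 - x)) (betaMeasure a b) := by
  have h := memLp_logs ha hb 0 1 1
  simp only [one_mul, zero_mul, zero_add] at h
  exact memLp_one_iff_integrable.1 h

theorem memLp_log {a b : ℝ} (ha : 0 < a) (hb : 0 < b) :
    MemLp Real.log 2 (betaMeasure a b) := by
  have h := memLp_logs ha hb 1 0 2
  simp only [one_mul, zero_mul, add_zero] at h
  exact h

theorem memLp_log_one_sub {a b : ℝ} (ha : 0 < a) (hb : 0 < b) :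
    MemLp (fun x => Real.log (1 - x)) 2 (betaMeasure a b) := by
  have h := memLp_logs ha hb 0 1 2
  simp only [one_mul, zero_mul, zero_add] at h
  exact h

theorem integral_log {a b : ℝ} (ha : 0 < a) (hb : 0 < b) :
    ∫ x, Real.log x ∂betaMeasure a b = polygamma 0 a - polygamma 0 (a + b) := by
  simpa using integral_logs ha hb 1 0

theorem integral_log_one_sub {a b : ℝ} (ha : 0 < a) (hb : 0 < b) :
    ∫ x, Real.log (1 - x) ∂betaMeasure a b = polygamma 0 b - polygamma 0 (a + b) := by
  simpa using integral_logs ha hb 0 1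

theorem integral_log_sq {a b : ℝ} (ha : 0 < a) (hb : 0 < b) :
    ∫ x, Real.log x ^ 2 ∂betaMeasure a b
      = polygamma 1 a - polygamma 1 (a + b) + (polygamma 0 a - polygamma 0 (a + b)) ^ 2 := by
  simpa using integral_logs_sq ha hb 1 0

theorem integral_log_one_sub_sq {a b : ℝ} (ha : 0 < a) (hb : 0 < b) :
    ∫ x, Real.log (1 - x) ^ 2 ∂betaMeasure a b
      = polygamma 1 b - polygamma 1 (a + b) + (polygamma 0 b - polygamma 0 (a + b)) ^ 2 := by
  simpa using integral_logs_sq ha hb 0 1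

/-- Polarisation: the case `s = t = 1` minus the two pure squares. -/
theorem integral_log_mul_log_one_sub {a b : ℝ} (ha : 0 < a) (hb : 0 < b) :
    ∫ x, Real.log x * Real.log (1 - x) ∂betaMeasure a b
      = -polygamma 1 (a + b)
        + (polygamma 0 a - polygamma 0 (a + b)) * (polygamma 0 b - polygamma 0 (a + b)) := by
  have h := integral_logs_sq ha hb 1 1
  have hX := (memLp_log ha hb).integrable_sq
  have hY := (memLp_log_one_sub ha hb).integrable_sq
  have hXY := ((memLp_log ha hb).integrable_mul (memLp_log_one_sub ha hb)).const_mul 2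
  have he : ∀ x : ℝ, (1 * Real.log x + 1 * Real.log (1 - x)) ^ 2
      = Real.log x ^ 2 + Real.log (1 - x) ^ 2 + 2 * (Real.log x * Real.log (1 - x)) := fun x => by
    ring
  simp only [he] at h
  have hXY' : Integrable (fun x => 2 * (Real.log x * Real.log (1 - x))) (betaMeasure a b) := hXY
  have hS : Integrable (fun x => Real.log x ^ 2 + Real.log (1 - x) ^ 2) (betaMeasure a b) :=
    hX.add hY
  rw [integral_add hS hXY', integral_add hX hY, integral_const_mul,
    integral_log_sq ha hb, integral_log_one_sub_sq ha hb] at h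
  linarith

/-- For `x < y`, the difference of the two sides is the variance of `log` under `Beta(x, y - x)`. -/
theorem polygamma_one_antitone {x y : ℝ} (hx : 0 < x) (hxy : x ≤ y) :
    polygamma 1 y ≤ polygamma 1 x := by
  rcases hxy.eq_or_lt with rfl | h
  · rfl
  have hd : 0 < y - x := sub_pos.2 h
  have := isProbabilityMeasureBeta hx hd
  have hv := variance_nonneg Real.log (betaMeasure x (y - x))
  rw [variance_eq_sub (memLp_log hx hd)] at hv
  simp only [Pi.pow_apply] at hv
  rw [integral_log_sq hx hd, integral_log hx hd, add_sub_cancel] at hv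
  linarith

/-! ### Moments of the binary entropy of a Beta variable -/

theorem integral_betaMeasure_pow_mul {a b : ℝ} (ha : 0 < a) (hb : 0 < b) (m n : ℕ) (f : ℝ → ℝ) :
    ∫ x, x ^ m * (1 - x) ^ n * f x ∂betaMeasure a b
      = beta (a + m) (b + n) / beta a b * ∫ x, f x ∂betaMeasure (a + m) (b + n) := by
  simpa using integral_betaMeasure_rpow_mul ha hb (s := m) (t := n) (by positivity)
    (by positivity) f

theorem integrable_betaMeasure_pow_mul {a b : ℝ} (ha : 0 < a) (hb : 0 < b) (m n : ℕ) {f : ℝ → ℝ}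
    (hf : Integrable f (betaMeasure (a + m) (b + n))) :
    Integrable (fun x => x ^ m * (1 - x) ^ n * f x) (betaMeasure a b) := by
  simpa using integrable_betaMeasure_rpow_mul ha hb (s := m) (t := n) (by positivity)
    (by positivity) hf

theorem beta_shift_two_zero {a b : ℝ} (ha : 0 < a) (hb : 0 < b) :
    beta (a + 2) b / beta a b = a * (a + 1) / ((a + b) * (a + b + 1)) := by
  have := (beta_pos ha hb).ne'
  rw [show a + 2 = a + 1 + 1 by ring, beta_add_one_left (by positivity) hb,
    beta_add_one_left ha hb]
  field_simp
  ring

theorem beta_shift_zero_two {a b : ℝ} (ha : 0 < a) (hb : 0 < b) :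
    beta a (b + 2) / beta a b = b * (b + 1) / ((a + b) * (a + b + 1)) := by
  have := (beta_pos ha hb).ne'
  rw [show b + 2 = b + 1 + 1 by ring, beta_add_one_right ha (by positivity),
    beta_add_one_right ha hb]
  field_simp
  ring

theorem beta_shift_one_one {a b : ℝ} (ha : 0 < a) (hb : 0 < b) :
    beta (a + 1) (b + 1) / beta a b = a * b / ((a + b) * (a + b + 1)) := by
  have := (beta_pos ha hb).ne'
  rw [beta_add_one_left ha (by positivity), beta_add_one_right ha hb]
  field_simp
  ring

theorem beta_shift_one_zero {a b : ℝ} (ha : 0 < a) (hb : 0 < b) :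
    beta (a + 1) b / beta a b = a / (a + b) := by
  have := (beta_pos ha hb).ne'
  rw [beta_add_one_left ha hb]
  field_simp

theorem beta_shift_zero_one {a b : ℝ} (ha : 0 < a) (hb : 0 < b) :
    beta a (b + 1) / beta a b = b / (a + b) := by
  have := (beta_pos ha hb).ne'
  rw [beta_add_one_right ha hb]
  field_simp

theorem integral_one_sub_betaMeasure {a b : ℝ} (ha : 0 < a) (hb : 0 < b) :
    ∫ x, (1 - x) ∂betaMeasure a b = b / (a + b) := by
  have := isProbabilityMeasureBeta ha (by positivity : 0 < b + 1)
  simpa [beta_shift_zero_one ha hb] using integral_betaMeasure_pow_mul ha hb 0 1 fun _ => 1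

theorem integral_one_sub_sq_betaMeasure {a b : ℝ} (ha : 0 < a) (hb : 0 < b) :
    ∫ x, (1 - x) ^ 2 ∂betaMeasure a b = b * (b + 1) / ((a + b) * (a + b + 1)) := by
  have := isProbabilityMeasureBeta ha (by positivity : 0 < b + 2)
  simpa [beta_shift_zero_two ha hb] using integral_betaMeasure_pow_mul ha hb 0 2 fun _ => 1

theorem binEntropy_eq_neg_sub (x : ℝ) :
    Real.binEntropy x = -(x * Real.log x) - (1 - x) * Real.log (1 - x) := by
  rw [Real.binEntropy, Real.log_inv, Real.log_inv]
  ring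

theorem integral_binEntropy {a b : ℝ} (ha : 0 < a) (hb : 0 < b) :
    ∫ x, Real.binEntropy x ∂betaMeasure a b
      = -(a / (a + b) * (polygamma 0 (a + 1) - polygamma 0 (a + 1 + b)))
        - b / (a + b) * (polygamma 0 (b + 1) - polygamma 0 (a + (b + 1))) := by
  have ha1 : 0 < a + 1 := by positivity
  have hb1 : 0 < b + 1 := by positivity
  have h1 := integral_betaMeasure_pow_mul ha hb 1 0 Real.log
  have h2 := integral_betaMeasure_pow_mul ha hb 0 1 fun x => Real.log (1 - x)
  have i1 := integrable_betaMeasure_pow_mul ha hb 1 0 (f := Real.log)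
    (by simpa using integrable_log ha1 hb)
  have i2 := integrable_betaMeasure_pow_mul ha hb 0 1 (f := fun x => Real.log (1 - x))
    (by simpa using integrable_log_one_sub ha hb1)
  simp only [pow_zero, pow_one, mul_one, one_mul, Nat.cast_zero, Nat.cast_one, add_zero]
    at h1 h2 i1 i2
  simp only [binEntropy_eq_neg_sub]
  rw [integral_sub i1.fun_neg i2, integral_neg, h1, h2, beta_shift_one_zero ha hb,
    beta_shift_zero_one ha hb, integral_log ha1 hb, integral_log_one_sub ha hb1]

theorem integral_one_sub_mul_binEntropy {a b : ℝ} (ha : 0 < a) (hb : 0 < b) :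
    ∫ x, (1 - x) * Real.binEntropy x ∂betaMeasure a b
      = -(a * b / ((a + b) * (a + b + 1))
          * (polygamma 0 (a + 1) - polygamma 0 (a + 1 + (b + 1))))
        - b * (b + 1) / ((a + b) * (a + b + 1))
          * (polygamma 0 (b + 2) - polygamma 0 (a + (b + 2))) := by
  have ha1 : 0 < a + 1 := by positivity
  have hb1 : 0 < b + 1 := by positivity
  have hb2 : 0 < b + 2 := by positivity
  have h1 := integral_betaMeasure_pow_mul ha hb 1 1 Real.log
  have h2 := integral_betaMeasure_pow_mul ha hb 0 2 fun x => Real.log (1 - x)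
  have i1 := integrable_betaMeasure_pow_mul ha hb 1 1 (f := Real.log)
    (by simpa using integrable_log ha1 hb1)
  have i2 := integrable_betaMeasure_pow_mul ha hb 0 2 (f := fun x => Real.log (1 - x))
    (by simpa using integrable_log_one_sub ha hb2)
  simp only [pow_zero, pow_one, one_mul, Nat.cast_zero, Nat.cast_one, add_zero, Nat.cast_ofNat]
    at h1 h2 i1 i2
  have he : ∀ x : ℝ, (1 - x) * Real.binEntropy x
      = -(x * (1 - x) * Real.log x) - (1 - x) ^ 2 * Real.log (1 - x) := fun x => by
    rw [binEntropy_eq_neg_sub]; ring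
  simp only [he]
  rw [integral_sub i1.fun_neg i2, integral_neg, h1, h2, beta_shift_one_one ha hb,
    beta_shift_zero_two ha hb, integral_log ha1 hb1, integral_log_one_sub ha hb2]

theorem integral_binEntropy_sq {a b : ℝ} (ha : 0 < a) (hb : 0 < b) :
    ∫ x, Real.binEntropy x ^ 2 ∂betaMeasure a b
      = a * (a + 1) / ((a + b) * (a + b + 1))
          * (polygamma 1 (a + 2) - polygamma 1 (a + 2 + b)
            + (polygamma 0 (a + 2) - polygamma 0 (a + 2 + b)) ^ 2)
        + 2 * (a * b / ((a + b) * (a + b + 1))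
          * (-polygamma 1 (a + 1 + (b + 1))
            + (polygamma 0 (a + 1) - polygamma 0 (a + 1 + (b + 1)))
              * (polygamma 0 (b + 1) - polygamma 0 (a + 1 + (b + 1)))))
        + b * (b + 1) / ((a + b) * (a + b + 1))
          * (polygamma 1 (b + 2) - polygamma 1 (a + (b + 2))
            + (polygamma 0 (b + 2) - polygamma 0 (a + (b + 2))) ^ 2) := by
  have ha1 : 0 < a + 1 := by positivity
  have hb1 : 0 < b + 1 := by positivity
  have ha2 : 0 < a + 2 := by positivity
  have hb2 : 0 < b + 2 := by positivity
  have h1 := integral_betaMeasure_pow_mul ha hb 2 0 fun x => Real.log x ^ 2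
  have h2 := integral_betaMeasure_pow_mul ha hb 1 1 fun x => Real.log x * Real.log (1 - x)
  have h3 := integral_betaMeasure_pow_mul ha hb 0 2 fun x => Real.log (1 - x) ^ 2
  have i1 := integrable_betaMeasure_pow_mul ha hb 2 0 (f := fun x => Real.log x ^ 2)
    (by simpa using (memLp_log ha2 hb).integrable_sq)
  have i2 := integrable_betaMeasure_pow_mul ha hb 1 1 (f := fun x => Real.log x * Real.log (1 - x))
    (by simpa [Pi.mul_def] using
      (memLp_log ha1 hb1).integrable_mul (memLp_log_one_sub ha1 hb1))
  have i3 := integrable_betaMeasure_pow_mul ha hb 0 2 (f := fun x => Real.log (1 - x) ^ 2)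
    (by simpa using (memLp_log_one_sub ha hb2).integrable_sq)
  simp only [pow_zero, pow_one, one_mul, mul_one, Nat.cast_zero, Nat.cast_one, add_zero,
    Nat.cast_ofNat] at h1 h2 h3 i1 i2 i3
  have he : ∀ x : ℝ, Real.binEntropy x ^ 2
      = x ^ 2 * Real.log x ^ 2 + 2 * (x * (1 - x) * (Real.log x * Real.log (1 - x)))
        + (1 - x) ^ 2 * Real.log (1 - x) ^ 2 := fun x => by
    rw [binEntropy_eq_neg_sub]; ring
  have i2' := i2.const_mul 2
  have i12 : Integrable (fun x => x ^ 2 * Real.log x ^ 2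
      + 2 * (x * (1 - x) * (Real.log x * Real.log (1 - x)))) (betaMeasure a b) := i1.add i2'
  simp only [he]
  rw [integral_add i12 i3, integral_add i1 i2', integral_const_mul, h1, h2, h3,
    beta_shift_one_one ha hb, beta_shift_zero_two ha hb, beta_shift_two_zero ha hb,
    integral_log_sq ha2 hb, integral_log_mul_log_one_sub ha1 hb1, integral_log_one_sub_sq ha hb2]

theorem integrable_betaMeasure_of_continuous {a b : ℝ} (ha : 0 < a) (hb : 0 < b) {f : ℝ → ℝ}
    (hf : Continuous f) : Integrable f (betaMeasure a b) := by
  have := isProbabilityMeasureBeta ha hb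
  obtain ⟨C, hC⟩ := (isCompact_Icc (a := (0 : ℝ)) (b := 1)).exists_bound_of_continuousOn
    hf.continuousOn
  refine Integrable.of_bound hf.aestronglyMeasurable C ?_
  filter_upwards [ae_betaMeasure_mem_Ioo a b] with x hx using hC x (Set.Ioo_subset_Icc_self hx)

/-! ### The recursions for mean and variance under one break -/

/-- The mean entropy of `PY(d, α)`. -/
noncomputable def meanEntropy (d α : ℝ) : ℝ := polygamma 0 (α + 1) - polygamma 0 (1 - d)

/-- The variance of the entropy of `PY(d, α)`. -/
noncomputable def varEntropy (d α : ℝ) : ℝ :=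
  (α + d) / ((α + 1) ^ 2 * (1 - d)) + (1 - d) / (α + 1) * polygamma 1 (2 - d)
    - polygamma 1 (2 + α)

/-- The increment of the compensated entropy, per unit of remaining stick, is centred. -/
theorem integral_step {d α : ℝ} (hd : d < 1) (hα : -d < α) :
    ∫ x, (Real.binEntropy x + (1 - x) * meanEntropy d (α + d) - meanEntropy d α)
      ∂betaMeasure (1 - d) (α + d) = 0 := by
  have ha : 0 < 1 - d := by linarith
  have hb : 0 < α + d := by linarith
  have := isProbabilityMeasureBeta ha hb
  have hc : ∀ f : ℝ → ℝ, Continuous f → Integrable f (betaMeasure (1 - d) (α + d)) :=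
    fun f hf => integrable_betaMeasure_of_continuous ha hb hf
  rw [integral_sub (hc _ (by fun_prop)) (hc _ (by fun_prop)),
    integral_add (hc _ (by fun_prop)) (hc _ (by fun_prop)), integral_mul_const,
    integral_one_sub_betaMeasure ha hb, integral_binEntropy ha hb, integral_const,
    probReal_univ, one_smul, meanEntropy, meanEntropy]
  have hab : 0 < (1 - d) + (α + d) := by linarith
  have e : α + 1 = (1 - d) + (α + d) := by ring
  rw [e]
  generalize 1 - d = a at *
  generalize α + d = b at *
  rw [show a + 1 + b = a + b + 1 by ring, show a + (b + 1) = a + b + 1 by ring,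
    polygamma_zero_add_one ha, polygamma_zero_add_one hab]
  field_simp
  ring

/-- The law of total variance for one break, checked directly on the closed formulas. -/
theorem integral_step_sq {d α : ℝ} (hd : d < 1) (hα : -d < α) :
    ∫ x, (Real.binEntropy x + (1 - x) * meanEntropy d (α + d) - meanEntropy d α) ^ 2
      ∂betaMeasure (1 - d) (α + d)
      = varEntropy d α
        - (∫ x, (1 - x) ^ 2 ∂betaMeasure (1 - d) (α + d)) * varEntropy d (α + d) := by
  have ha : 0 < 1 - d := by linarith
  have hb : 0 < α + d := by linarith
  have hc : ∀ f : ℝ → ℝ, Continuous f → Integrable f (betaMeasure (1 - d) (α + d)) :=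
    fun f hf => integrable_betaMeasure_of_continuous ha hb hf
  have h0 := integral_step hd hα
  set c := meanEntropy d (α + d) with hcdef
  set m := meanEntropy d α with hmdef
  have := isProbabilityMeasureBeta ha hb
  -- The linear part is grouped as the centred integrand of `integral_step`, so it integrates to
  -- zero.
  have he : ∀ x : ℝ, (Real.binEntropy x + (1 - x) * c - m) ^ 2
      = Real.binEntropy x ^ 2 + 2 * c * ((1 - x) * Real.binEntropy x) + c ^ 2 * (1 - x) ^ 2
        - 2 * m * (Real.binEntropy x + (1 - x) * c - m) - m ^ 2 := fun x => by ring
  simp only [he]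
  rw [integral_sub (hc _ (by fun_prop)) (hc _ (by fun_prop)),
    integral_sub (hc _ (by fun_prop)) (hc _ (by fun_prop)),
    integral_add (hc _ (by fun_prop)) (hc _ (by fun_prop)),
    integral_add (hc _ (by fun_prop)) (hc _ (by fun_prop)),
    integral_const_mul, integral_const_mul, integral_const_mul, h0,
    integral_one_sub_sq_betaMeasure ha hb, integral_binEntropy_sq ha hb,
    integral_one_sub_mul_binEntropy ha hb, integral_const, probReal_univ, one_smul, hcdef, hmdef,
    meanEntropy, meanEntropy, varEntropy, varEntropy]
  have hab : 0 < (1 - d) + (α + d) := by linarith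
  -- Everything is rewritten in the Beta shapes `a = 1 - d` and `b = α + d`.
  have e1 : α + 1 = (1 - d) + (α + d) := by ring
  have e2 : α + d + d = (α + d) + 1 - (1 - d) := by ring
  have e3 : 2 - d = (1 - d) + 1 := by ring
  have e4 : 2 + α = (1 - d) + (α + d) + 1 := by ring
  rw [e1, e2, e3, e4]
  generalize 1 - d = a at *
  generalize α + d = b at *
  clear_value c m
  clear he hc h0 e1 e2 e3 e4
  rw [show a + 2 + b = a + b + 1 + 1 by ring, show a + 1 + (b + 1) = a + b + 1 + 1 by ring,
    show a + (b + 2) = a + b + 1 + 1 by ring, show a + 2 = a + 1 + 1 by ring,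
    show b + 2 = b + 1 + 1 by ring, show 2 + b = b + 1 + 1 by ring]
  have ha1 : 0 < a + 1 := by positivity
  have hb1 : 0 < b + 1 := by positivity
  have hab1 : 0 < a + b + 1 := by positivity
  -- The recurrences bring the polygamma values to common arguments, leaving an identity of rational
  -- functions in which those values are free symbols.
  rw [polygamma_zero_add_one ha1, polygamma_zero_add_one hb1, polygamma_zero_add_one hab1,
    polygamma_zero_add_one ha, polygamma_zero_add_one hb, polygamma_zero_add_one hab,
    polygamma_one_add_one ha1, polygamma_one_add_one hb1, polygamma_one_add_one hab1,
    polygamma_one_add_one ha, polygamma_one_add_one hab]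
  field_simp
  ring

/-! ### The remaining stick, the partial entropy and its compensation -/

/-- The length `(1 - q 0) ⋯ (1 - q (n - 1))` of stick left after `n` breaks. -/
noncomputable def remaining (q : ℕ → ℝ) (n : ℕ) : ℝ := ∏ j ∈ Finset.range n, (1 - q j)

/-- The entropy of the partition of the unit stick into `n + 1` pieces made by the first `n`
breaks. -/
noncomputable def partialEntropy (q : ℕ → ℝ) (n : ℕ) : ℝ :=
  ∑ i ∈ Finset.range n, remaining q i * Real.binEntropy (q i)

/-- The conditional expectation of the entropy of `PY(d, α)` given the first `n` breaks. -/
noncomputable def compensatedEntropy (d α : ℝ) (q : ℕ → ℝ) (n : ℕ) : ℝ :=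
  partialEntropy q n + remaining q n * meanEntropy d (α + n * d)

theorem remaining_succ (q : ℕ → ℝ) (n : ℕ) :
    remaining q (n + 1) = remaining q n * (1 - q n) := Finset.prod_range_succ _ _

theorem partialEntropy_succ (q : ℕ → ℝ) (n : ℕ) :
    partialEntropy q (n + 1) = partialEntropy q n + remaining q n * Real.binEntropy (q n) :=
  Finset.sum_range_succ _ _

theorem compensatedEntropy_succ (d α : ℝ) (q : ℕ → ℝ) (n : ℕ) :
    compensatedEntropy d α q (n + 1) = compensatedEntropy d α q n
      + remaining q n * (Real.binEntropy (q n) + (1 - q n) * meanEntropy d (α + n * d + d)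
        - meanEntropy d (α + n * d)) := by
  rw [compensatedEntropy, compensatedEntropy, remaining_succ, partialEntropy_succ,
    show α + ((n + 1 : ℕ) : ℝ) * d = α + n * d + d by push_cast; ring]
  ring

theorem remaining_congr {q q' : ℕ → ℝ} {n : ℕ} (h : ∀ i < n, q i = q' i) :
    remaining q n = remaining q' n :=
  Finset.prod_congr rfl fun i hi => by rw [h i (Finset.mem_range.1 hi)]

theorem partialEntropy_congr {q q' : ℕ → ℝ} {n : ℕ} (h : ∀ i < n, q i = q' i) :
    partialEntropy q n = partialEntropy q' n :=
  Finset.sum_congr rfl fun i hi => by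
    have hi := Finset.mem_range.1 hi
    rw [h i hi, remaining_congr fun j hj => h j (hj.trans hi)]

theorem measurable_remaining (n : ℕ) : Measurable fun q => remaining q n := by
  unfold remaining; fun_prop

theorem measurable_partialEntropy (n : ℕ) : Measurable fun q => partialEntropy q n := by
  unfold partialEntropy
  have := measurable_remaining
  exact Finset.measurable_fun_sum _ fun i _ =>
    (this i).mul (Real.binEntropy_continuous.measurable.comp (measurable_pi_apply i))

theorem measurable_compensatedEntropy (d α : ℝ) (n : ℕ) :
    Measurable fun q => compensatedEntropy d α q n :=
  (measurable_partialEntropy n).add ((measurable_remaining n).mul_const _)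

/-! ### Pathwise bounds and convergence -/

section Deterministic

variable {q : ℕ → ℝ}

theorem remaining_nonneg (hq : ∀ i, q i ∈ Set.Icc (0 : ℝ) 1) (n : ℕ) : 0 ≤ remaining q n :=
  Finset.prod_nonneg fun i _ => by linarith [(hq i).2]

theorem antitone_remaining (hq : ∀ i, q i ∈ Set.Icc (0 : ℝ) 1) : Antitone (remaining q) :=
  antitone_nat_of_succ_le fun n => by
    rw [remaining_succ]
    exact mul_le_of_le_one_right (remaining_nonneg hq n) (by linarith [(hq n).1])

theorem remaining_le_one (hq : ∀ i, q i ∈ Set.Icc (0 : ℝ) 1) (n : ℕ) : remaining q n ≤ 1 := by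
  simpa [remaining] using antitone_remaining hq n.zero_le

theorem monotone_partialEntropy (hq : ∀ i, q i ∈ Set.Icc (0 : ℝ) 1) :
    Monotone (partialEntropy q) :=
  monotone_nat_of_le_succ fun n => by
    rw [partialEntropy_succ]
    exact le_add_of_nonneg_right
      (mul_nonneg (remaining_nonneg hq n) (Real.binEntropy_nonneg (hq n).1 (hq n).2))

theorem partialEntropy_nonneg (hq : ∀ i, q i ∈ Set.Icc (0 : ℝ) 1) (n : ℕ) :
    0 ≤ partialEntropy q n := by
  simpa [partialEntropy] using monotone_partialEntropy hq n.zero_le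

theorem partialEntropy_le (hq : ∀ i, q i ∈ Set.Icc (0 : ℝ) 1) (n : ℕ) :
    partialEntropy q n ≤ n * Real.log 2 := by
  refine (Finset.sum_le_card_nsmul _ _ (Real.log 2) fun i _ => ?_).trans_eq (by simp)
  exact (mul_le_of_le_one_left (Real.binEntropy_nonneg (hq i).1 (hq i).2)
    (remaining_le_one hq i)).trans Real.binEntropy_le_log_two

/-- The chain rule for entropy: each break splits the remainder `R` into `Rx` and `R(1 - x)`, adding
`R h(x)`. -/
theorem partialEntropy_eq_sum (q : ℕ → ℝ) (n : ℕ) :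
    partialEntropy q n = ∑ i ∈ Finset.range n, Real.negMulLog (stickBreaking q i)
      + Real.negMulLog (remaining q n) := by
  induction n with
  | zero => simp [partialEntropy, remaining]
  | succ n ih =>
    rw [partialEntropy_succ, ih, Finset.sum_range_succ, remaining_succ,
      show stickBreaking q n = remaining q n * q n from rfl, Real.negMulLog_mul,
      Real.negMulLog_mul, Real.binEntropy_eq_negMulLog_add_negMulLog_one_sub]
    ring

theorem stickBreaking_mem_Icc (hq : ∀ i, q i ∈ Set.Icc (0 : ℝ) 1) (i : ℕ) :
    stickBreaking q i ∈ Set.Icc (0 : ℝ) 1 :=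
  ⟨mul_nonneg (remaining_nonneg hq i) (hq i).1,
    mul_le_one₀ (remaining_le_one hq i) (hq i).1 (hq i).2⟩

/-- The finite partition differs from the first `n` weights only by the leftover piece, whose
entropy term tends to `0` with its length. -/
theorem hasSum_negMulLog_stickBreaking (hq : ∀ i, q i ∈ Set.Icc (0 : ℝ) 1) {H : ℝ}
    (hR : Tendsto (remaining q) atTop (𝓝 0)) (hG : Tendsto (partialEntropy q) atTop (𝓝 H)) :
    HasSum (fun i => Real.negMulLog (stickBreaking q i)) H := by
  have hn : ∀ i, 0 ≤ Real.negMulLog (stickBreaking q i) := fun i =>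
    Real.negMulLog_nonneg (stickBreaking_mem_Icc hq i).1 (stickBreaking_mem_Icc hq i).2
  rw [hasSum_iff_tendsto_nat_of_nonneg hn]
  have h := hG.sub ((Real.continuous_negMulLog.tendsto 0).comp hR)
  rw [Real.negMulLog_zero, sub_zero] at h
  refine h.congr fun n => ?_
  rw [partialEntropy_eq_sum]
  simp

end Deterministic

/-! ### Monotone sequences with bounded integrals -/

section MonotoneLimits

variable {Ω : Type*} [MeasurableSpace Ω] {P : Measure Ω} {f : ℕ → Ω → ℝ} {C : ℝ}

theorem lintegral_iSup_ofReal_lt_top (hf : ∀ n, Integrable (f n) P)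
    (h0 : ∀ᵐ ω ∂P, ∀ n, 0 ≤ f n ω) (hm : ∀ᵐ ω ∂P, Monotone fun n => f n ω)
    (hC : ∀ n, ∫ ω, f n ω ∂P ≤ C) : ∫⁻ ω, ⨆ n, ENNReal.ofReal (f n ω) ∂P < ⊤ := by
  rw [lintegral_iSup' (fun n => (hf n).aemeasurable.ennreal_ofReal)
    (hm.mono fun ω h n m hnm => ENNReal.ofReal_le_ofReal (h hnm))]
  refine (iSup_le fun n => ?_).trans_lt (ENNReal.ofReal_lt_top (r := C))
  rw [← ofReal_integral_eq_lintegral_ofReal (hf n) (h0.mono fun ω h => h n)]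
  exact ENNReal.ofReal_le_ofReal (hC n)

theorem ae_bddAbove_of_integral_le (hf : ∀ n, Integrable (f n) P)
    (h0 : ∀ᵐ ω ∂P, ∀ n, 0 ≤ f n ω) (hm : ∀ᵐ ω ∂P, Monotone fun n => f n ω)
    (hC : ∀ n, ∫ ω, f n ω ∂P ≤ C) : ∀ᵐ ω ∂P, BddAbove (Set.range fun n => f n ω) := by
  have h := ae_lt_top' (AEMeasurable.iSup fun n => (hf n).aemeasurable.ennreal_ofReal)
    (lintegral_iSup_ofReal_lt_top hf h0 hm hC).ne
  filter_upwards [h] with ω hω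
  refine ⟨(⨆ n, ENNReal.ofReal (f n ω)).toReal, ?_⟩
  rintro _ ⟨n, rfl⟩
  exact (ENNReal.ofReal_le_iff_le_toReal hω.ne).1 (le_iSup (fun n => ENNReal.ofReal (f n ω)) n)

theorem integrable_of_tendsto_of_integral_le (hf : ∀ n, Integrable (f n) P)
    (h0 : ∀ᵐ ω ∂P, ∀ n, 0 ≤ f n ω) (hm : ∀ᵐ ω ∂P, Monotone fun n => f n ω)
    (hC : ∀ n, ∫ ω, f n ω ∂P ≤ C) {F : Ω → ℝ}
    (hF : ∀ᵐ ω ∂P, Tendsto (fun n => f n ω) atTop (𝓝 (F ω))) : Integrable F P := by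
  refine ⟨aestronglyMeasurable_of_tendsto_ae _ (fun n => (hf n).aestronglyMeasurable) hF, ?_⟩
  rw [hasFiniteIntegral_iff_ofReal]
  · refine lt_of_le_of_lt (lintegral_mono_ae ?_) (lintegral_iSup_ofReal_lt_top hf h0 hm hC)
    filter_upwards [hF] with ω hω
    exact le_of_tendsto' ((ENNReal.continuous_ofReal.tendsto _).comp hω)
      fun n => le_iSup (fun n => ENNReal.ofReal (f n ω)) n
  · filter_upwards [hF, h0] with ω hω h using ge_of_tendsto' hω h

end MonotoneLimits

/-! ### Independence of a break from the earlier ones -/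

section Stick

variable {Ω : Type*} [MeasurableSpace Ω] {d α : ℝ} {b : ℕ → Ω → ℝ} {P : Measure Ω}

theorem IsStickFractions.ae_mem_Ioo (h : IsStickFractions d α b P) :
    ∀ᵐ ω ∂P, ∀ i, b i ω ∈ Set.Ioo (0 : ℝ) 1 := by
  rw [ae_all_iff]
  intro i
  have := ae_betaMeasure_mem_Ioo (1 - d) (α + ((i : ℝ) + 1) * d)
  rw [← (h.hasLaw i).map_eq] at this
  exact ae_of_ae_map (h.hasLaw i).aemeasurable this

theorem IsStickFractions.ae_mem_Icc (h : IsStickFractions d α b P) :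
    ∀ᵐ ω ∂P, ∀ i, b i ω ∈ Set.Icc (0 : ℝ) 1 :=
  h.ae_mem_Ioo.mono fun _ hω i => Set.Ioo_subset_Icc_self (hω i)

theorem IsStickFractions.aemeasurable (h : IsStickFractions d α b P) :
    AEMeasurable (fun ω i => b i ω) P :=
  aemeasurable_pi_lambda _ fun i => (h.hasLaw i).aemeasurable

theorem IsStickFractions.indepFun (h : IsStickFractions d α b P) {Φ : (ℕ → ℝ) → ℝ}
    (hΦ : Measurable Φ) {n : ℕ} (hn : ∀ q q' : ℕ → ℝ, (∀ i < n, q i = q' i) → Φ q = Φ q') :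
    IndepFun (fun ω => Φ fun i => b i ω) (b n) P := by
  have hi := h.indep.indepFun_finset₀ (Finset.range n) {n} (by simp)
    fun i => (h.hasLaw i).aemeasurable
  -- The coordinates from `n` on are filled with `0`; by `hn` this does not change the value of `Φ`.
  have hφ : Measurable fun y : Finset.range n → ℝ =>
      Φ fun i => if hi : i ∈ Finset.range n then y ⟨i, hi⟩ else 0 := by
    refine hΦ.comp (measurable_pi_lambda _ fun i => ?_)
    by_cases hi : i ∈ Finset.range n
    · simpa only [dif_pos hi] using measurable_pi_apply _
    · simpa only [dif_neg hi] using measurable_const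
  have hψ : Measurable fun y : ({n} : Finset ℕ) → ℝ => y ⟨n, by simp⟩ := measurable_pi_apply _
  have := hi.comp hφ hψ
  have he : (fun ω => Φ fun i => b i ω) = (fun y : Finset.range n → ℝ =>
      Φ fun i => if hi : i ∈ Finset.range n then y ⟨i, hi⟩ else 0) ∘
        fun ω (i : Finset.range n) => b i ω := by
    funext ω
    exact hn _ _ fun i hi => by simp [hi]
  rw [he]
  exact this

/-- Plays the role of conditioning on the first `n` breaks. The second shape is written `α + n * d +
d` to match the first break of `PY(d, α + n d)`. -/
theorem IsStickFractions.integral_mul (h : IsStickFractions d α b P) {Φ : (ℕ → ℝ) → ℝ}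
    (hΦ : Measurable Φ) {n : ℕ} (hn : ∀ q q' : ℕ → ℝ, (∀ i < n, q i = q' i) → Φ q = Φ q')
    {g : ℝ → ℝ} (hg : Continuous g) :
    ∫ ω, Φ (fun i => b i ω) * g (b n ω) ∂P = (∫ ω, Φ (fun i => b i ω) ∂P)
      * ∫ x, g x ∂betaMeasure (1 - d) (α + n * d + d) := by
  have hi := (h.indepFun hΦ hn).comp measurable_id hg.measurable
  have hl := h.hasLaw n
  have h1 := hi.integral_fun_mul_eq_mul_integral
    (hΦ.comp_aemeasurable h.aemeasurable).aestronglyMeasurable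
    (hg.measurable.comp_aemeasurable hl.aemeasurable).aestronglyMeasurable
  rw [hl.integral_comp hg.aestronglyMeasurable] at h1
  rw [show α + n * d + d = α + ((n : ℝ) + 1) * d by ring]
  exact h1

theorem IsStickFractions.integrable_of_bound (h : IsStickFractions d α b P) {Φ : (ℕ → ℝ) → ℝ}
    (hΦ : Measurable Φ) {C : ℝ}
    (hC : ∀ q : ℕ → ℝ, (∀ i, q i ∈ Set.Icc (0 : ℝ) 1) → |Φ q| ≤ C) :
    Integrable (fun ω => Φ fun i => b i ω) P := by
  have := h.indep.isProbabilityMeasure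
  exact Integrable.of_bound (hΦ.comp_aemeasurable h.aemeasurable).aestronglyMeasurable C
    (h.ae_mem_Icc.mono fun ω hω => hC _ hω)

end Stick

/-! ### Moments of the compensated entropy -/

section Moments

variable {Ω : Type*} [MeasurableSpace Ω] {d α : ℝ} {b : ℕ → Ω → ℝ} {P : Measure Ω}

theorem neg_lt_shift (hd0 : 0 ≤ d) (hα : -d < α) (n : ℕ) : -d < α + n * d := by
  have : 0 ≤ n * d := by positivity
  linarith

theorem abs_compensatedEntropy_le {q : ℕ → ℝ} (hq : ∀ i, q i ∈ Set.Icc (0 : ℝ) 1) (n : ℕ) :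
    |compensatedEntropy d α q n| ≤ n * Real.log 2 + |meanEntropy d (α + n * d)| := by
  refine (abs_add_le _ _).trans (add_le_add ?_ ?_)
  · rw [abs_of_nonneg (partialEntropy_nonneg hq n)]
    exact partialEntropy_le hq n
  · rw [abs_mul, abs_of_nonneg (remaining_nonneg hq n)]
    exact mul_le_of_le_one_left (abs_nonneg _) (remaining_le_one hq n)

theorem IsStickFractions.integrable_remaining (h : IsStickFractions d α b P) (n : ℕ) :
    Integrable (fun ω => remaining (fun i => b i ω) n) P :=
  h.integrable_of_bound (measurable_remaining n) (C := 1) fun q hq => by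
    rw [abs_of_nonneg (remaining_nonneg hq n)]
    exact remaining_le_one hq n

theorem IsStickFractions.integrable_partialEntropy (h : IsStickFractions d α b P) (n : ℕ) :
    Integrable (fun ω => partialEntropy (fun i => b i ω) n) P :=
  h.integrable_of_bound (measurable_partialEntropy n) fun q hq => by
    rw [abs_of_nonneg (partialEntropy_nonneg hq n)]
    exact partialEntropy_le hq n

theorem IsStickFractions.integrable_remaining_sq (h : IsStickFractions d α b P) (n : ℕ) :
    Integrable (fun ω => remaining (fun i => b i ω) n ^ 2) P :=
  h.integrable_of_bound ((measurable_remaining n).pow_const 2) (C := 1) fun q hq => by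
    rw [abs_of_nonneg (sq_nonneg _)]
    exact pow_le_one₀ (remaining_nonneg hq n) (remaining_le_one hq n)

theorem IsStickFractions.integrable_partialEntropy_sq (h : IsStickFractions d α b P) (n : ℕ) :
    Integrable (fun ω => partialEntropy (fun i => b i ω) n ^ 2) P :=
  h.integrable_of_bound ((measurable_partialEntropy n).pow_const 2) fun q hq => by
    rw [abs_of_nonneg (sq_nonneg _)]
    exact pow_le_pow_left₀ (partialEntropy_nonneg hq n) (partialEntropy_le hq n) 2

theorem IsStickFractions.integrable_compensatedEntropy (h : IsStickFractions d α b P) (n : ℕ) :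
    Integrable (fun ω => compensatedEntropy d α (fun i => b i ω) n) P :=
  h.integrable_of_bound (measurable_compensatedEntropy d α n) fun _ hq =>
    abs_compensatedEntropy_le hq n

theorem IsStickFractions.integrable_compensatedEntropy_sq (h : IsStickFractions d α b P) (n : ℕ) :
    Integrable (fun ω => compensatedEntropy d α (fun i => b i ω) n ^ 2) P :=
  h.integrable_of_bound ((measurable_compensatedEntropy d α n).pow_const 2) fun q hq => by
    rw [abs_pow]
    exact pow_le_pow_left₀ (abs_nonneg _) (abs_compensatedEntropy_le hq n) 2

theorem IsStickFractions.integrable_compensatedEntropy_mul_remaining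
    (h : IsStickFractions d α b P) (n : ℕ) :
    Integrable (fun ω => compensatedEntropy d α (fun i => b i ω) n
      * remaining (fun i => b i ω) n) P :=
  h.integrable_of_bound ((measurable_compensatedEntropy d α n).mul (measurable_remaining n))
    fun q hq => by
    rw [Pi.mul_apply, abs_mul, abs_of_nonneg (remaining_nonneg hq n)]
    exact (mul_le_of_le_one_right (abs_nonneg _) (remaining_le_one hq n)).trans
      (abs_compensatedEntropy_le hq n)

theorem IsStickFractions.integral_remaining_succ (h : IsStickFractions d α b P) (hd0 : 0 ≤ d)
    (hd1 : d < 1) (hα : -d < α) (n : ℕ) :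
    ∫ ω, remaining (fun i => b i ω) (n + 1) ∂P
      = (∫ ω, remaining (fun i => b i ω) n ∂P) * (1 - (1 - d) / (α + 1 + n * d)) := by
  have hn := neg_lt_shift hd0 hα n
  simp only [remaining_succ]
  rw [h.integral_mul (measurable_remaining n) (fun _ _ => remaining_congr)
    (g := fun x => 1 - x) (by fun_prop), integral_one_sub_betaMeasure (by linarith) (by linarith)]
  have h0 : 0 < α + 1 + n * d := by linarith
  have h1 : 0 < 1 - d + (α + n * d + d) := by linarith
  congr 1
  field_simp
  ring

theorem IsStickFractions.integral_remaining_sq_succ (h : IsStickFractions d α b P) (n : ℕ) :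
    ∫ ω, remaining (fun i => b i ω) (n + 1) ^ 2 ∂P
      = (∫ ω, remaining (fun i => b i ω) n ^ 2 ∂P)
        * ∫ x, (1 - x) ^ 2 ∂betaMeasure (1 - d) (α + n * d + d) := by
  simp only [remaining_succ, mul_pow]
  exact h.integral_mul ((measurable_remaining n).pow_const 2)
    (fun _ _ hq => by rw [remaining_congr hq]) (g := fun x => (1 - x) ^ 2) (by fun_prop)

/-- The martingale property in integrated form: each increment is `R_n` times an independent centred
variable. -/
theorem IsStickFractions.integral_compensatedEntropy (h : IsStickFractions d α b P) (hd0 : 0 ≤ d)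
    (hd1 : d < 1) (hα : -d < α) (n : ℕ) :
    ∫ ω, compensatedEntropy d α (fun i => b i ω) n ∂P = meanEntropy d α := by
  have := h.indep.isProbabilityMeasure
  induction n with
  | zero => simp [compensatedEntropy, partialEntropy, remaining]
  | succ n ih =>
    have hs := h.integral_mul (measurable_remaining n) (fun _ _ => remaining_congr)
      (g := fun x => Real.binEntropy x + (1 - x) * meanEntropy d (α + n * d + d)
        - meanEntropy d (α + n * d)) (by fun_prop)
    rw [integral_step hd1 (neg_lt_shift hd0 hα n), mul_zero] at hs
    have hi : ∀ k, Integrable (fun ω => compensatedEntropy d α (fun i => b i ω) k) P :=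
      h.integrable_compensatedEntropy
    have he := integral_sub (hi (n + 1)) (hi n)
    simp only [compensatedEntropy_succ, add_sub_cancel_left] at he
    simp only [compensatedEntropy_succ]
    linarith

/-- Increments are orthogonal to the past, so their second moments add. By `integral_step_sq` the
`n`-th one is `E[R_n²] V(α + n d) - E[R_{n+1}²] V(α + (n + 1) d)`, which telescopes. -/
theorem IsStickFractions.integral_compensatedEntropy_sq (h : IsStickFractions d α b P)
    (hd0 : 0 ≤ d) (hd1 : d < 1) (hα : -d < α) (n : ℕ) :
    ∫ ω, compensatedEntropy d α (fun i => b i ω) n ^ 2 ∂P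
      = meanEntropy d α ^ 2 + varEntropy d α
        - (∫ ω, remaining (fun i => b i ω) n ^ 2 ∂P) * varEntropy d (α + n * d) := by
  have := h.indep.isProbabilityMeasure
  induction n with
  | zero => simp [compensatedEntropy, partialEntropy, remaining]
  | succ n ih =>
    have hc : Continuous fun x => Real.binEntropy x + (1 - x) * meanEntropy d (α + n * d + d)
        - meanEntropy d (α + n * d) := by fun_prop
    have h1 := h.integral_mul
      ((measurable_compensatedEntropy d α n).mul (measurable_remaining n)) (n := n)
      (fun q q' hq => by
        simp only [Pi.mul_apply, compensatedEntropy, remaining_congr hq, partialEntropy_congr hq])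
      hc
    have h2 := h.integral_mul ((measurable_remaining n).pow_const 2) (n := n)
      (fun q q' hq => by rw [remaining_congr hq]) (hc.pow 2)
    rw [integral_step hd1 (neg_lt_shift hd0 hα n), mul_zero] at h1
    simp only [Pi.pow_apply] at h2
    rw [integral_step_sq hd1 (neg_lt_shift hd0 hα n), mul_sub, ← mul_assoc,
      ← h.integral_remaining_sq_succ] at h2
    simp only [Pi.mul_apply] at h1
    have he : ∀ ω, compensatedEntropy d α (fun i => b i ω) (n + 1) ^ 2
        - compensatedEntropy d α (fun i => b i ω) n ^ 2
        - 2 * (compensatedEntropy d α (fun i => b i ω) n * remaining (fun i => b i ω) n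
          * (Real.binEntropy (b n ω) + (1 - b n ω) * meanEntropy d (α + n * d + d)
            - meanEntropy d (α + n * d)))
        = remaining (fun i => b i ω) n ^ 2
          * (Real.binEntropy (b n ω) + (1 - b n ω) * meanEntropy d (α + n * d + d)
            - meanEntropy d (α + n * d)) ^ 2 := fun ω => by
      rw [compensatedEntropy_succ]; ring
    have hX : Integrable (fun ω => compensatedEntropy d α (fun i => b i ω) n
        * remaining (fun i => b i ω) n
          * (Real.binEntropy (b n ω) + (1 - b n ω) * meanEntropy d (α + n * d + d)
            - meanEntropy d (α + n * d))) P := by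
      obtain ⟨C, hC⟩ := (isCompact_Icc (a := (0 : ℝ)) (b := 1)).exists_bound_of_continuousOn
        hc.continuousOn
      refine (h.integrable_compensatedEntropy_mul_remaining n).mul_bdd (c := C)
        (hc.measurable.comp_aemeasurable (h.hasLaw n).aemeasurable).aestronglyMeasurable ?_
      filter_upwards [h.ae_mem_Icc] with ω hω using hC _ (hω n)
    have hi : ∀ k, Integrable (fun ω => compensatedEntropy d α (fun i => b i ω) k ^ 2) P :=
      h.integrable_compensatedEntropy_sq
    have hI := integral_sub ((hi (n + 1)).sub (hi n)) (hX.const_mul 2)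
    simp only [Pi.sub_apply, he] at hI
    rw [integral_sub (hi (n + 1)) (hi n), integral_const_mul, h1, ih] at hI
    rw [show α + ((n + 1 : ℕ) : ℝ) * d = α + n * d + d by push_cast; ring]
    linarith

end Moments

/-! ### Growth of the mean and boundedness of the variance under shifts of `α` -/

section Growth

variable {d α : ℝ}

/-- The partial sums `∑ 1 / (α + 1 + j d)`, which control the decay of the remaining stick and the
growth of the mean entropy. -/
noncomputable def shapeSum (d α : ℝ) (n : ℕ) : ℝ := ∑ j ∈ Finset.range n, (α + 1 + j * d)⁻¹

theorem shift_pos (hd0 : 0 ≤ d) (hd1 : d < 1) (hα : -d < α) (n : ℕ) : 0 < α + 1 + n * d := by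
  have := neg_lt_shift hd0 hα n
  linarith

theorem tendsto_shapeSum (hd0 : 0 ≤ d) (hd1 : d < 1) (hα : -d < α) :
    Tendsto (shapeSum d α) atTop atTop := by
  have hc : 0 < α + 2 := by linarith
  have h := Real.tendsto_sum_range_one_div_nat_succ_atTop.const_mul_atTop (inv_pos.2 hc)
  refine tendsto_atTop_mono (fun n => ?_) h
  rw [shapeSum, Finset.mul_sum]
  refine Finset.sum_le_sum fun j _ => ?_
  rw [one_div, ← mul_inv]
  -- Comparison with the harmonic series: `α + 1 + j d ≤ (α + 2)(j + 1)`.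
  refine inv_anti₀ (shift_pos hd0 hd1 hα j) ?_
  have h1 : (j : ℝ) * d ≤ j := mul_le_of_le_one_right j.cast_nonneg hd1.le
  have h2 : (0 : ℝ) ≤ j * (α + 1) := mul_nonneg j.cast_nonneg (by linarith)
  nlinarith

theorem meanEntropy_nonneg (hd1 : d < 1) (hα : -d < α) : 0 ≤ meanEntropy d α :=
  sub_nonneg.2 (polygamma_zero_mono (by linarith) (by linarith))

/-- As `d < 1`, monotonicity gives `ψ₀(x + d) ≤ ψ₀(x + 1) = ψ₀(x) + 1/x`. -/
theorem meanEntropy_shift_le (hd0 : 0 ≤ d) (hd1 : d < 1) (hα : -d < α) (n : ℕ) :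
    meanEntropy d (α + n * d) ≤ meanEntropy d α + shapeSum d α n := by
  induction n with
  | zero => simp [shapeSum]
  | succ n ih =>
    have hp := shift_pos hd0 hd1 hα n
    have h1 : polygamma 0 (α + ((n + 1 : ℕ) : ℝ) * d + 1) ≤ polygamma 0 (α + 1 + n * d + 1) := by
      refine polygamma_zero_mono ?_ ?_ <;> push_cast <;> linarith
    rw [polygamma_zero_add_one hp] at h1
    rw [shapeSum, Finset.sum_range_succ, ← shapeSum]
    rw [meanEntropy, show α + n * d + 1 = α + 1 + n * d by ring] at ih
    rw [meanEntropy]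
    linarith

/-- The bound does not depend on `n`: in the rational term `d < 1` cancels one factor of the square,
and `ψ₁` is nonnegative and antitone. -/
theorem abs_varEntropy_shift_le (hd0 : 0 ≤ d) (hd1 : d < 1) (hα : -d < α) (n : ℕ) :
    |varEntropy d (α + n * d)| ≤ 1 / ((α + 1) * (1 - d)) + (1 - d) / (α + 1) * polygamma 1 (2 - d)
      + polygamma 1 (2 + α) := by
  have hn := neg_lt_shift hd0 hα n
  have h0 : 0 ≤ n * d := by positivity
  have hα1 : 0 < α + 1 := by linarith
  have hd : 0 < 1 - d := by linarith
  have hn1 : 0 < α + n * d + 1 := by linarith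
  have hnd : 0 < α + n * d + d := by linarith
  have p1 : 0 ≤ polygamma 1 (2 - d) := polygamma_one_nonneg (by linarith)
  have p2 : 0 ≤ polygamma 1 (2 + (α + n * d)) := polygamma_one_nonneg (by linarith)
  have p3 : polygamma 1 (2 + (α + n * d)) ≤ polygamma 1 (2 + α) :=
    polygamma_one_antitone (by linarith) (by linarith)
  have e1 : (α + n * d + d) / ((α + n * d + 1) ^ 2 * (1 - d)) ≤ 1 / ((α + 1) * (1 - d)) := by
    rw [div_le_div_iff₀ (by positivity) (by positivity), one_mul, ← mul_assoc]
    refine mul_le_mul_of_nonneg_right ?_ hd.le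
    rw [pow_two]
    exact mul_le_mul (by linarith) (by linarith) hα1.le hn1.le
  have e2 : (1 - d) / (α + n * d + 1) * polygamma 1 (2 - d)
      ≤ (1 - d) / (α + 1) * polygamma 1 (2 - d) := by
    refine mul_le_mul_of_nonneg_right ?_ p1
    exact div_le_div_of_nonneg_left hd.le hα1 (by linarith)
  have e3 : 0 ≤ (α + n * d + d) / ((α + n * d + 1) ^ 2 * (1 - d)) := by positivity
  have e4 : 0 ≤ (1 - d) / (α + n * d + 1) * polygamma 1 (2 - d) := by positivity
  rw [varEntropy, abs_le]
  constructor <;> linarith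

end Growth

/-! ### Decay of the remaining stick -/

section Limits

variable {Ω : Type*} [MeasurableSpace Ω] {d α : ℝ} {b : ℕ → Ω → ℝ} {P : Measure Ω}

theorem IsStickFractions.integral_remaining_nonneg (h : IsStickFractions d α b P) (n : ℕ) :
    0 ≤ ∫ ω, remaining (fun i => b i ω) n ∂P :=
  integral_nonneg_of_ae (h.ae_mem_Icc.mono fun _ hω => remaining_nonneg hω n)

/-- Each factor `1 - x` of the product for `E R_n` is at most `exp (-x)`. -/
theorem IsStickFractions.integral_remaining_le (h : IsStickFractions d α b P) (hd0 : 0 ≤ d)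
    (hd1 : d < 1) (hα : -d < α) (n : ℕ) :
    ∫ ω, remaining (fun i => b i ω) n ∂P ≤ Real.exp (-((1 - d) * shapeSum d α n)) := by
  have := h.indep.isProbabilityMeasure
  induction n with
  | zero => simp [remaining, shapeSum]
  | succ n ih =>
    rw [h.integral_remaining_succ hd0 hd1 hα, shapeSum, Finset.sum_range_succ, ← shapeSum,
      mul_add, neg_add, Real.exp_add]
    refine (mul_le_mul_of_nonneg_left ?_ (h.integral_remaining_nonneg n)).trans
      (mul_le_mul_of_nonneg_right ih (Real.exp_pos _).le)
    have := Real.add_one_le_exp (-((1 - d) * (α + 1 + n * d)⁻¹))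
    rw [div_eq_mul_inv]
    linarith

theorem IsStickFractions.integral_remaining_sq_le (h : IsStickFractions d α b P) (hd0 : 0 ≤ d)
    (hd1 : d < 1) (hα : -d < α) (n : ℕ) :
    ∫ ω, remaining (fun i => b i ω) n ^ 2 ∂P ≤ Real.exp (-((1 - d) * shapeSum d α n)) := by
  refine (integral_mono_ae (h.integrable_remaining_sq n) (h.integrable_remaining n) ?_).trans
    (h.integral_remaining_le hd0 hd1 hα n)
  filter_upwards [h.ae_mem_Icc] with ω hω
  exact pow_le_of_le_one (remaining_nonneg hω n) (remaining_le_one hω n) two_ne_zero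

end Limits

theorem tendsto_add_mul_exp_neg (F : ℝ) {c : ℝ} (hc : 0 < c) :
    Tendsto (fun x => (F + x) * Real.exp (-(c * x))) atTop (𝓝 0) := by
  have hx : Tendsto (fun x : ℝ => c * x) atTop atTop := tendsto_id.const_mul_atTop hc
  have h0 := ((Real.tendsto_pow_mul_exp_neg_atTop_nhds_zero 0).comp hx).const_mul F
  have h1 := ((Real.tendsto_pow_mul_exp_neg_atTop_nhds_zero 1).comp hx).const_mul c⁻¹
  have h := h0.add h1
  simp only [mul_zero, add_zero] at h
  refine h.congr fun x => ?_
  simp only [Function.comp_apply, pow_zero, pow_one, one_mul]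
  field_simp

/-! ### Passage to the limit for the stick-breaking order -/

section Limits

variable {Ω : Type*} [MeasurableSpace Ω] {d α : ℝ} {b : ℕ → Ω → ℝ} {P : Measure Ω}

/-- A null sequence that dominates the terms by which the moments of the partial entropy differ
from those of the compensated entropy. -/
noncomputable def decay (d α : ℝ) (n : ℕ) : ℝ :=
  (meanEntropy d α + shapeSum d α n) * Real.exp (-((1 - d) / 2 * shapeSum d α n))

theorem tendsto_decay (hd0 : 0 ≤ d) (hd1 : d < 1) (hα : -d < α) :
    Tendsto (decay d α) atTop (𝓝 0) :=
  (tendsto_add_mul_exp_neg _ (by linarith)).comp (tendsto_shapeSum hd0 hd1 hα)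

theorem shapeSum_nonneg (hd0 : 0 ≤ d) (hd1 : d < 1) (hα : -d < α) (n : ℕ) :
    0 ≤ shapeSum d α n :=
  Finset.sum_nonneg fun j _ => (inv_pos.2 (shift_pos hd0 hd1 hα j)).le

/-- The halved exponent in `decay` is the square root of the bound on `E[R_n²]`, as the cross term
`E[M_n R_n]` requires. -/
theorem exp_neg_mul_shapeSum_eq_sq (d α : ℝ) (n : ℕ) :
    Real.exp (-((1 - d) * shapeSum d α n)) = Real.exp (-((1 - d) / 2 * shapeSum d α n)) ^ 2 := by
  rw [← Real.exp_nat_mul]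
  congr 1
  push_cast
  ring

theorem IsStickFractions.tendsto_integral_remaining_sq_mul_varEntropy
    (h : IsStickFractions d α b P) (hd0 : 0 ≤ d) (hd1 : d < 1) (hα : -d < α) :
    Tendsto (fun n => (∫ ω, remaining (fun i => b i ω) n ^ 2 ∂P) * varEntropy d (α + n * d))
      atTop (𝓝 0) := by
  have hd : 0 < 1 - d := by linarith
  have h0 : Tendsto (fun n => Real.exp (-((1 - d) * shapeSum d α n))) atTop (𝓝 0) :=
    Real.tendsto_exp_neg_atTop_nhds_zero.comp
      ((tendsto_shapeSum hd0 hd1 hα).const_mul_atTop hd)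
  have h1 := h0.mul_const (1 / ((α + 1) * (1 - d)) + (1 - d) / (α + 1) * polygamma 1 (2 - d)
      + polygamma 1 (2 + α))
  rw [zero_mul] at h1
  refine squeeze_zero_norm (fun n => ?_) h1
  rw [norm_mul, Real.norm_eq_abs, Real.norm_eq_abs]
  refine mul_le_mul ?_ (abs_varEntropy_shift_le hd0 hd1 hα n) (abs_nonneg _) (Real.exp_pos _).le
  rw [abs_of_nonneg (integral_nonneg fun ω => sq_nonneg _)]
  exact h.integral_remaining_sq_le hd0 hd1 hα n

theorem IsStickFractions.tendsto_integral_compensatedEntropy_sq (h : IsStickFractions d α b P)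
    (hd0 : 0 ≤ d) (hd1 : d < 1) (hα : -d < α) :
    Tendsto (fun n => ∫ ω, compensatedEntropy d α (fun i => b i ω) n ^ 2 ∂P) atTop
      (𝓝 (meanEntropy d α ^ 2 + varEntropy d α)) := by
  simp only [h.integral_compensatedEntropy_sq hd0 hd1 hα]
  simpa using tendsto_const_nhds.sub
    (h.tendsto_integral_remaining_sq_mul_varEntropy hd0 hd1 hα)

theorem IsStickFractions.tendsto_integral_partialEntropy (h : IsStickFractions d α b P)
    (hd0 : 0 ≤ d) (hd1 : d < 1) (hα : -d < α) :
    Tendsto (fun n => ∫ ω, partialEntropy (fun i => b i ω) n ∂P) atTop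
      (𝓝 (meanEntropy d α)) := by
  have hd : 0 < 1 - d := by linarith
  have he : ∀ n, ∫ ω, partialEntropy (fun i => b i ω) n ∂P
      = meanEntropy d α - (∫ ω, remaining (fun i => b i ω) n ∂P) * meanEntropy d (α + n * d) :=
    fun n => by
      rw [← h.integral_compensatedEntropy hd0 hd1 hα n]
      simp only [compensatedEntropy]
      rw [integral_add (h.integrable_partialEntropy n) ((h.integrable_remaining n).mul_const _),
        integral_mul_const]
      ring
  have h0 : Tendsto (fun n => (∫ ω, remaining (fun i => b i ω) n ∂P)
      * meanEntropy d (α + n * d)) atTop (𝓝 0) := by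
    refine squeeze_zero (fun n => mul_nonneg (h.integral_remaining_nonneg n)
      (meanEntropy_nonneg hd1 (neg_lt_shift hd0 hα n))) (fun n => ?_) (tendsto_decay hd0 hd1 hα)
    rw [mul_comm, decay]
    refine mul_le_mul (meanEntropy_shift_le hd0 hd1 hα n) ?_ (h.integral_remaining_nonneg n)
      (add_nonneg (meanEntropy_nonneg hd1 hα) (shapeSum_nonneg hd0 hd1 hα n))
    refine (h.integral_remaining_le hd0 hd1 hα n).trans (Real.exp_le_exp.2 ?_)
    nlinarith [mul_nonneg hd.le (shapeSum_nonneg hd0 hd1 hα n)]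
  simp only [he]
  simpa using tendsto_const_nhds.sub h0

/-- A weighted form of Cauchy–Schwarz: integrate `2ρMR ≤ ρ²M² + R²`, use `E[R²] ≤ ρ²`, and divide by
`2ρ`. -/
theorem IsStickFractions.integral_compensatedEntropy_mul_remaining_le
    (h : IsStickFractions d α b P) (hd0 : 0 ≤ d) (hd1 : d < 1) (hα : -d < α) (n : ℕ) :
    ∫ ω, compensatedEntropy d α (fun i => b i ω) n * remaining (fun i => b i ω) n ∂P
      ≤ Real.exp (-((1 - d) / 2 * shapeSum d α n))
        * (((∫ ω, compensatedEntropy d α (fun i => b i ω) n ^ 2 ∂P) + 1) / 2) := by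
  set ρ := Real.exp (-((1 - d) / 2 * shapeSum d α n)) with hρ
  have hρ0 : 0 < ρ := Real.exp_pos _
  have h2 := h.integral_remaining_sq_le hd0 hd1 hα n
  rw [exp_neg_mul_shapeSum_eq_sq] at h2
  have hm : ∫ ω, (2 * ρ) * (compensatedEntropy d α (fun i => b i ω) n
        * remaining (fun i => b i ω) n) ∂P
      ≤ ∫ ω, (ρ ^ 2 * compensatedEntropy d α (fun i => b i ω) n ^ 2
        + remaining (fun i => b i ω) n ^ 2) ∂P := by
    refine integral_mono ((h.integrable_compensatedEntropy_mul_remaining n).const_mul _)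
      (((h.integrable_compensatedEntropy_sq n).const_mul _).add (h.integrable_remaining_sq n))
      fun ω => ?_
    simp only
    nlinarith [sq_nonneg (ρ * compensatedEntropy d α (fun i => b i ω) n
      - remaining (fun i => b i ω) n)]
  rw [integral_const_mul, integral_add ((h.integrable_compensatedEntropy_sq n).const_mul _)
    (h.integrable_remaining_sq n), integral_const_mul] at hm
  refine le_of_mul_le_mul_left (hm.trans ?_) (by positivity : 0 < 2 * ρ)
  nlinarith

theorem compensatedEntropy_nonneg (hd0 : 0 ≤ d) (hd1 : d < 1) (hα : -d < α) {q : ℕ → ℝ}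
    (hq : ∀ i, q i ∈ Set.Icc (0 : ℝ) 1) (n : ℕ) : 0 ≤ compensatedEntropy d α q n :=
  add_nonneg (partialEntropy_nonneg hq n)
    (mul_nonneg (remaining_nonneg hq n) (meanEntropy_nonneg hd1 (neg_lt_shift hd0 hα n)))

/-- Expand `G_n² = (M_n - F(α + n d) R_n)²`; the last two terms are dominated by `decay` times a
convergent sequence and by `decay ^ 2`. -/
theorem IsStickFractions.tendsto_integral_partialEntropy_sq (h : IsStickFractions d α b P)
    (hd0 : 0 ≤ d) (hd1 : d < 1) (hα : -d < α) :
    Tendsto (fun n => ∫ ω, partialEntropy (fun i => b i ω) n ^ 2 ∂P) atTop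
      (𝓝 (meanEntropy d α ^ 2 + varEntropy d α)) := by
  have hF : ∀ n : ℕ, 0 ≤ meanEntropy d (α + n * d) := fun n =>
    meanEntropy_nonneg hd1 (neg_lt_shift hd0 hα n)
  have hFle := meanEntropy_shift_le hd0 hd1 hα
  have hV := h.tendsto_integral_compensatedEntropy_sq hd0 hd1 hα
  have hS : ∀ n, 0 ≤ meanEntropy d α + shapeSum d α n := fun n =>
    add_nonneg (meanEntropy_nonneg hd1 hα) (shapeSum_nonneg hd0 hd1 hα n)
  have hX : Tendsto (fun n : ℕ => meanEntropy d (α + n * d) * ∫ ω, compensatedEntropy d α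
      (fun i => b i ω) n * remaining (fun i => b i ω) n ∂P) atTop (𝓝 0) := by
    have hz := (tendsto_decay hd0 hd1 hα).mul ((hV.add_const 1).div_const 2)
    rw [zero_mul] at hz
    have hnn : ∀ n, 0 ≤ ∫ ω, compensatedEntropy d α (fun i => b i ω) n
        * remaining (fun i => b i ω) n ∂P := fun n =>
      integral_nonneg_of_ae (h.ae_mem_Icc.mono fun ω hω =>
        mul_nonneg (compensatedEntropy_nonneg hd0 hd1 hα hω n) (remaining_nonneg hω n))
    refine squeeze_zero (fun n => mul_nonneg (hF n) (hnn n)) (fun n => ?_) hz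
    rw [decay, mul_assoc]
    exact mul_le_mul (hFle n) (h.integral_compensatedEntropy_mul_remaining_le hd0 hd1 hα n)
      (hnn n) (hS n)
  have hR : Tendsto (fun n : ℕ => meanEntropy d (α + n * d) ^ 2
      * ∫ ω, remaining (fun i => b i ω) n ^ 2 ∂P) atTop (𝓝 0) := by
    have hz := (tendsto_decay hd0 hd1 hα).pow 2
    rw [zero_pow two_ne_zero] at hz
    have hnn : ∀ n, 0 ≤ ∫ ω, remaining (fun i => b i ω) n ^ 2 ∂P := fun n =>
      integral_nonneg fun ω => sq_nonneg _
    refine squeeze_zero (fun n => mul_nonneg (sq_nonneg _) (hnn n)) (fun n => ?_) hz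
    rw [decay, mul_pow, ← exp_neg_mul_shapeSum_eq_sq]
    exact mul_le_mul (pow_le_pow_left₀ (hF n) (hFle n) 2)
      (h.integral_remaining_sq_le hd0 hd1 hα n) (hnn n) (sq_nonneg _)
  have hz := (hV.sub (hX.const_mul 2)).add hR
  simp only [mul_zero, sub_zero, add_zero] at hz
  refine hz.congr fun n => ?_
  have i1 := h.integrable_compensatedEntropy_sq n
  have i2 := (h.integrable_compensatedEntropy_mul_remaining n).const_mul
    (2 * meanEntropy d (α + n * d))
  have i3 := (h.integrable_remaining_sq n).const_mul (meanEntropy d (α + n * d) ^ 2)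
  have i12 : Integrable (fun ω => compensatedEntropy d α (fun i => b i ω) n ^ 2
      - 2 * meanEntropy d (α + n * d) * (compensatedEntropy d α (fun i => b i ω) n
        * remaining (fun i => b i ω) n)) P := i1.sub i2
  have he : ∀ ω, partialEntropy (fun i => b i ω) n ^ 2
      = compensatedEntropy d α (fun i => b i ω) n ^ 2
      - 2 * meanEntropy d (α + n * d) * (compensatedEntropy d α (fun i => b i ω) n
        * remaining (fun i => b i ω) n)
      + meanEntropy d (α + n * d) ^ 2 * remaining (fun i => b i ω) n ^ 2 := fun ω => by
    rw [compensatedEntropy]; ring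
  simp only [he]
  rw [integral_add i12 i3, integral_sub i1 i2, integral_const_mul, integral_const_mul]
  ring

theorem IsStickFractions.ae_tendsto_remaining (h : IsStickFractions d α b P)
    (hd0 : 0 ≤ d) (hd1 : d < 1) (hα : -d < α) :
    ∀ᵐ ω ∂P, Tendsto (remaining fun i => b i ω) atTop (𝓝 0) := by
  have h0 : Tendsto (fun n => Real.exp (-((1 - d) * shapeSum d α n))) atTop (𝓝 0) :=
    Real.tendsto_exp_neg_atTop_nhds_zero.comp
      ((tendsto_shapeSum hd0 hd1 hα).const_mul_atTop (by linarith))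
  refine tendsto_of_integral_tendsto_of_antitone (F := fun _ => 0) h.integrable_remaining
    (integrable_zero _ _ _) ?_ (h.ae_mem_Icc.mono fun ω hω => antitone_remaining hω)
    (h.ae_mem_Icc.mono fun ω hω => remaining_nonneg hω)
  rw [integral_zero]
  exact squeeze_zero h.integral_remaining_nonneg (h.integral_remaining_le hd0 hd1 hα) h0

theorem IsStickFractions.ae_tendsto_partialEntropy (h : IsStickFractions d α b P)
    (hd0 : 0 ≤ d) (hd1 : d < 1) (hα : -d < α) :
    ∀ᵐ ω ∂P, Tendsto (partialEntropy fun i => b i ω) atTop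
      (𝓝 (⨆ n, partialEntropy (fun i => b i ω) n)) := by
  obtain ⟨C, hC⟩ := (h.tendsto_integral_partialEntropy hd0 hd1 hα).bddAbove_range
  have hb := ae_bddAbove_of_integral_le h.integrable_partialEntropy
    (h.ae_mem_Icc.mono fun ω hω => partialEntropy_nonneg hω)
    (h.ae_mem_Icc.mono fun ω hω => monotone_partialEntropy hω) fun n => hC ⟨n, rfl⟩
  filter_upwards [hb, h.ae_mem_Icc] with ω hω hq
  exact tendsto_atTop_ciSup (monotone_partialEntropy hq) hω

theorem entropy_eq_tsum_negMulLog (p : ℕ → ℝ) : entropy p = ∑' i, Real.negMulLog (p i) := by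
  simp only [entropy, Real.negMulLog_eq_neg, tsum_neg]

theorem IsStickFractions.ae_hasSum (h : IsStickFractions d α b P) (hd0 : 0 ≤ d) (hd1 : d < 1)
    (hα : -d < α) :
    ∀ᵐ ω ∂P, Tendsto (partialEntropy fun i => b i ω) atTop
        (𝓝 (entropy (stickBreaking fun i => b i ω)))
      ∧ Summable fun i => Real.negMulLog (stickBreaking (fun i => b i ω) i) := by
  filter_upwards [h.ae_tendsto_partialEntropy hd0 hd1 hα, h.ae_tendsto_remaining hd0 hd1 hα,
    h.ae_mem_Icc] with ω hG hR hq
  have hs := hasSum_negMulLog_stickBreaking hq hR hG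
  rw [entropy_eq_tsum_negMulLog, hs.tsum_eq]
  exact ⟨hG, hs.summable⟩

/-- `G_n²` increases to `H²`, and its integrals are bounded because they converge. -/
theorem IsStickFractions.integrable_entropy_sq (h : IsStickFractions d α b P) (hd0 : 0 ≤ d)
    (hd1 : d < 1) (hα : -d < α) :
    Integrable (fun ω => entropy (stickBreaking fun i => b i ω) ^ 2) P := by
  obtain ⟨C, hC⟩ := (h.tendsto_integral_partialEntropy_sq hd0 hd1 hα).bddAbove_range
  refine integrable_of_tendsto_of_integral_le (C := C) h.integrable_partialEntropy_sq
    (ae_of_all _ fun ω n => sq_nonneg _) ?_ (fun n => hC ⟨n, rfl⟩)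
    ((h.ae_hasSum hd0 hd1 hα).mono fun ω hω => hω.1.pow 2)
  filter_upwards [h.ae_mem_Icc] with ω hω n m hnm
  exact pow_le_pow_left₀ (partialEntropy_nonneg hω n) (monotone_partialEntropy hω hnm) 2

theorem IsStickFractions.memLp_entropy (h : IsStickFractions d α b P) (hd0 : 0 ≤ d)
    (hd1 : d < 1) (hα : -d < α) :
    MemLp (fun ω => entropy (stickBreaking fun i => b i ω)) 2 P :=
  (memLp_two_iff_integrable_sq (aestronglyMeasurable_of_tendsto_ae _
    (fun n => (h.integrable_partialEntropy n).aestronglyMeasurable)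
    ((h.ae_hasSum hd0 hd1 hα).mono fun _ hω => hω.1))).2 (h.integrable_entropy_sq hd0 hd1 hα)

theorem IsStickFractions.integral_entropy (h : IsStickFractions d α b P) (hd0 : 0 ≤ d)
    (hd1 : d < 1) (hα : -d < α) :
    ∫ ω, entropy (stickBreaking fun i => b i ω) ∂P = meanEntropy d α := by
  have := h.indep.isProbabilityMeasure
  refine tendsto_nhds_unique (integral_tendsto_of_tendsto_of_monotone h.integrable_partialEntropy
    ((h.memLp_entropy hd0 hd1 hα).integrable one_le_two)
    (h.ae_mem_Icc.mono fun ω hω => monotone_partialEntropy hω)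
    ((h.ae_hasSum hd0 hd1 hα).mono fun _ hω => hω.1)) ?_
  exact h.tendsto_integral_partialEntropy hd0 hd1 hα

theorem IsStickFractions.variance_entropy (h : IsStickFractions d α b P) (hd0 : 0 ≤ d)
    (hd1 : d < 1) (hα : -d < α) :
    variance (fun ω => entropy (stickBreaking fun i => b i ω)) P = varEntropy d α := by
  have := h.indep.isProbabilityMeasure
  have h2 : ∫ ω, entropy (stickBreaking fun i => b i ω) ^ 2 ∂P
      = meanEntropy d α ^ 2 + varEntropy d α := by
    refine tendsto_nhds_unique (integral_tendsto_of_tendsto_of_monotone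
      h.integrable_partialEntropy_sq (h.integrable_entropy_sq hd0 hd1 hα) ?_
      ((h.ae_hasSum hd0 hd1 hα).mono fun _ hω => hω.1.pow 2))
      (h.tendsto_integral_partialEntropy_sq hd0 hd1 hα)
    filter_upwards [h.ae_mem_Icc] with ω hω n m hnm
    exact pow_le_pow_left₀ (partialEntropy_nonneg hω n) (monotone_partialEntropy hω hnm) 2
  rw [variance_eq_sub (h.memLp_entropy hd0 hd1 hα), h.integral_entropy hd0 hd1 hα]
  simp only [Pi.pow_apply]
  rw [h2, add_sub_cancel_left]

end Limits

/-! ### Permutation invariance and transfer through the coupling -/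

/-- The entropy of a sequence of weights as an extended nonnegative number. -/
noncomputable def entropyENNReal (p : ℕ → ℝ) : ENNReal :=
  ∑' i, ENNReal.ofReal (Real.negMulLog (p i))

/-- The sequences of weights in `[0, 1]` with finite entropy. -/
def finiteEntropy : Set (ℕ → ℝ) := {p | (∀ i, p i ∈ Set.Icc (0 : ℝ) 1) ∧ entropyENNReal p < ⊤}

theorem measurable_entropyENNReal : Measurable entropyENNReal :=
  Measurable.tsum fun i =>
    (Real.continuous_negMulLog.measurable.comp (measurable_pi_apply i)).ennreal_ofReal

theorem measurableSet_finiteEntropy : MeasurableSet finiteEntropy :=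
  (measurableSet_setOfPred.2 (Measurable.forall fun i =>
    measurableSet_setOfPred.1 (measurable_pi_apply i measurableSet_Icc))).inter
    (measurable_entropyENNReal measurableSet_Iio)

theorem summable_of_mem_finiteEntropy {p : ℕ → ℝ} (hp : p ∈ finiteEntropy) :
    Summable fun i => Real.negMulLog (p i) := by
  refine (ENNReal.summable_toReal hp.2.ne).congr fun i => ?_
  exact ENNReal.toReal_ofReal (Real.negMulLog_nonneg (hp.1 i).1 (hp.1 i).2)

/-- Finite entropy is not needed: if the series diverges, both sides take the default value `0`. -/
theorem entropy_eq_toReal {p : ℕ → ℝ} (hp : ∀ i, p i ∈ Set.Icc (0 : ℝ) 1) :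
    entropy p = (entropyENNReal p).toReal := by
  rw [entropy_eq_tsum_negMulLog, entropyENNReal, ENNReal.tsum_toReal_eq (by simp)]
  exact tsum_congr fun i =>
    (ENNReal.toReal_ofReal (Real.negMulLog_nonneg (hp i).1 (hp i).2)).symm

theorem entropyENNReal_comp_perm (p : ℕ → ℝ) (σ : Equiv.Perm ℕ) :
    entropyENNReal (fun i => p (σ i)) = entropyENNReal p :=
  σ.tsum_eq fun i => ENNReal.ofReal (Real.negMulLog (p i))

end PitmanYor

theorem mainTheorem5 {Ω : Type*} [MeasurableSpace Ω] (P : Measure Ω) [IsProbabilityMeasure P]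
    (d α : ℝ) (hd0 : 0 ≤ d) (hd1 : d < 1) (hα : -d < α)
    (π : Ω → ℕ → ℝ) (hπ : PitmanYor.IsPitmanYor d α π P) :
    (∀ᵐ ω ∂P, Summable fun i => π ω i * Real.log (π ω i)) ∧
    MemLp (fun ω => PitmanYor.entropy (π ω)) 2 P ∧
    ∫ ω, PitmanYor.entropy (π ω) ∂P
      = PitmanYor.polygamma 0 (α + 1) - PitmanYor.polygamma 0 (1 - d) ∧
    variance (fun ω => PitmanYor.entropy (π ω)) P
      = (α + d) / ((α + 1) ^ 2 * (1 - d))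
        + (1 - d) / (α + 1) * PitmanYor.polygamma 1 (2 - d)
        - PitmanYor.polygamma 1 (2 + α) := by
  obtain ⟨hm, ν, hν, hb, hσ⟩ := hπ
  -- The random permutation is eliminated pathwise, so no measurable choice of it is needed.
  have hk : ∀ᵐ x ∂ν, x.1 ∈ PitmanYor.finiteEntropy ∧ (PitmanYor.entropyENNReal x.1).toReal
      = PitmanYor.entropy (PitmanYor.stickBreaking fun i => x.2 i) := by
    filter_upwards [hσ, hb.ae_hasSum hd0 hd1 hα, hb.ae_mem_Icc] with x ⟨σ, hx⟩ hs hq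
    have hI : ∀ i, x.1 i ∈ Set.Icc (0 : ℝ) 1 := fun i => by
      rw [← σ.apply_symm_apply i, ← hx]
      exact PitmanYor.stickBreaking_mem_Icc hq _
    have he : PitmanYor.entropyENNReal (PitmanYor.stickBreaking x.2)
        = PitmanYor.entropyENNReal x.1 := by
      rw [← PitmanYor.entropyENNReal_comp_perm x.1 σ]
      exact congrArg _ (funext hx)
    refine ⟨⟨hI, ?_⟩, ?_⟩
    · rw [← he]
      exact hs.2.tsum_ofReal_lt_top
    · rw [← he]
      exact (PitmanYor.entropy_eq_toReal (PitmanYor.stickBreaking_mem_Icc hq)).symm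
  -- Measurability of `finiteEntropy` lets the almost sure statement pass from `ν` to the common law
  -- of `π` and the first component.
  have hfin : ∀ᵐ ω ∂P, π ω ∈ PitmanYor.finiteEntropy := by
    refine ae_of_ae_map hm ?_
    rw [← hν]
    exact (ae_map_iff measurable_fst.aemeasurable PitmanYor.measurableSet_finiteEntropy).2
      (hk.mono fun x hx => hx.1)
  have hg : Measurable fun p => (PitmanYor.entropyENNReal p).toReal :=
    PitmanYor.measurable_entropyENNReal.ennreal_toReal
  have hP : (fun ω => PitmanYor.entropy (π ω))
      =ᵐ[P] (fun p => (PitmanYor.entropyENNReal p).toReal) ∘ π :=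
    hfin.mono fun ω hω => PitmanYor.entropy_eq_toReal hω.1
  have hνe : (fun p => (PitmanYor.entropyENNReal p).toReal) ∘ Prod.fst
      =ᵐ[ν] fun x => PitmanYor.entropy (PitmanYor.stickBreaking fun i => x.2 i) :=
    hk.mono fun x hx => hx.2
  refine ⟨?_, ?_, ?_, ?_⟩
  · filter_upwards [hfin] with ω hω
    have := (PitmanYor.summable_of_mem_finiteEntropy hω).neg
    simpa [Real.negMulLog_eq_neg] using this
  -- The measurable version of the entropy moves the claim from `P` to the law of `π`, then to `ν`,
  -- where it becomes the entropy of the stick-breaking weights. The mean and the variance follow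
  -- the same route.
  · rw [memLp_congr_ae hP, ← memLp_map_measure_iff hg.aestronglyMeasurable hm, ← hν,
      memLp_map_measure_iff hg.aestronglyMeasurable measurable_fst.aemeasurable,
      memLp_congr_ae hνe]
    exact hb.memLp_entropy hd0 hd1 hα
  · rw [integral_congr_ae hP]
    simp only [Function.comp_apply]
    rw [← integral_map (f := fun p => (PitmanYor.entropyENNReal p).toReal) hm
        hg.aestronglyMeasurable, ← hν,
      integral_map measurable_fst.aemeasurable hg.aestronglyMeasurable]
    exact (integral_congr_ae hνe).trans (hb.integral_entropy hd0 hd1 hα)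
  · rw [variance_congr hP, ← variance_map hg.aemeasurable hm, ← hν,
      variance_map hg.aemeasurable measurable_fst.aemeasurable, variance_congr hνe]
    exact hb.variance_entropy hd0 hd1 hα
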